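/- Setting. Throughout, functions are real-valued, $N$ ranges over the powers $2^n$ ($n=0,1,2,\dots$), and $\rho$ is a quasi-metric on $\mathbb X$: $\rho\ge 0$ is symmetric, $\rho(x,y)=0$ iff $x=y$, and $\rho(x,z)\le\kappa(\rho(x,y)+\rho(y,z))$ for some constant $\kappa\ge1$. $\mathbb X$ carries the topology of $\rho$ (a set $U$ is open iff every $x\in U$ has some $t>0$ with $\{y:\rho(x,y)<t\}\subseteq U$) and a Borel probability measure $\mu$. Let $B_t(x)=\{y:\rho(x,y)\le t\}$. Let $(\varphi_k)_{k\ge0}$ be an orthonormal basis of $L_2(\mathbb X,\mu)$ consisting of continuous functions with $\varphi_0\equiv1$, and let $0=\lambda_0\le\lambda_1\le\cdots$, $\lambda_k\to\infty$. Put $\Pi_M=\operatorname{span}\{\varphi_k:\lambda_k\le M\}$ for real $M$, and $G_t(x,y)=\sum_k e^{-\lambda_k^2t}\varphi_k(x)\varphi_k(y)$. Assume that $\mathbb X$ is a diffusion measure space: there are $\alpha>0$ and constants $C_0,c_0>0$ such that all balls $B_t(x)$, $t>0$, are compact with $\mu(B_t(x))\le C_0t^\alpha$; $|G_t(x,y)|\le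 C_0t^{-\alpha/2}\exp(-c_0\rho(x,y)^2/t)$ for $0<t\le1$ and all $x,y$; and $G_t(x,x)\ge c_0t^{-\alpha/2}$ for $0<t<1$ and all $x$. Assume the strong product assumption, with a constant $a>0$ fixed so that $fg\in\Pi_{aN}$ for all $f\in\Pi_N$, $g\in\Pi_{2N}$ and all $N$. Fix $1\le p\le\infty$. A family $(\nu_N)$ of finite signed Borel measures is called a uniform family of Marcinkiewicz-Zygmund quadrature measures if $\int P\,d\mu=\int P\,d\nu_N$ for all $P\in\Pi_{aN}$ and all $N$, and if there are constants $c_1,C_1>0$, independent of $N$, with $c_1\|P\|_{L_p(\mu)}\le\|P\|_{L_p(|\nu_N|)}\le C_1\|P\|_{L_p(\mu)}$ for all $P\in\Pi_{aN}$ and, in case $p=\infty$, also $\|P\|_{L_1(|\nu_N|)}\le C_1\|P\|_{L_1(\mu)}$ for all $P\in\Pi_{aN}$. If $p=\infty$, let $(\mu_N)$ be a uniform family of Marcinkiewicz-Zygmund quadrature measures; if $p<\infty$, let $\mu_N=\mu$ for all $N$. Let $(\nu_N)$ be a uniform family of Marcinkiewicz-Zygmund quadrature measures such that $\operatorname{supp}\nu_N$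 is finite and $\#\operatorname{supp}\nu_N\le C_2N^\alpha$ with $C_2$ independent of $N$. Let $H:[0,\infty)\to\mathbb R$ be infinitely differentiable and non-increasing with $H=1$ on $[0,1/2]$ and $H=0$ on $[1,\infty)$. For $S>1$, a function $f$ and a Borel set $A\subseteq\mathbb X$ put $$\sigma_N(f,\mu_N,x)=\sum_kH(\lambda_k/N)\,\varphi_k(x)\int f\varphi_k\,d\mu_N,\qquad I_N(f,\mu_N,y)=\lfloor N^S\sigma_N(f,\mu_N,y)\rfloor,$$ $$\sigma_N^\circ(f,\mu_N,\nu_N,A)(x)=N^{-S}\int_A I_N(f,\mu_N,y)\sum_kH\Big(\frac{\lambda_k}{2N}\Big)\varphi_k(y)\varphi_k(x)\,d\nu_N(y).$$ Let $X_p$ be the $L_p(\mu)$-closure of $\bigcup_N\Pi_N$ (for $p=\infty$ its elements are taken continuous), and put $E_q(f,\Pi_N)=\inf_{P\in\Pi_N}\|f-P\|_{L_q(\mu)}$. Let $C^\infty(\mathbb X)$ be the set of continuous $\phi$ such that $\sup_NN^{s'}E_\infty(\phi,\Pi_N)<\infty$ for every $s'>0$ and $\|\phi\|_{L_\infty}<\infty$.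 Let $B'=B_{t'}(x_0)$ and $B=B_t(x_0)$ with $0<t'<t$, and let $\phi\in C^\infty(\mathbb X)$ be equal to $1$ on $B'$ and $0$ outside of $B$. For $s,r>0$ put $$\overline{W^s_r}(L_p(\mathbb X),\phi)=\Big\{f\in X_p:\ \|f\|_{L_p(\mu)}+\sup_NN^sE_p(f\phi,\Pi_N)\le r\Big\}.$$ The number of bits of an integer $m$ is the number of binary digits of $|m|$ (none for $m=0$) plus one bit for the sign. Theorem. Let $s>0$, $S>\max(1,s)$ and $r_0>0$. Then there are constants $c,C>0$, independent of $r$, $N$, $f$ and $\varepsilon$, such that for all $r\ge r_0$, all $N=2^n$ and all $f\in\overline{W^s_r}(L_p(\mathbb X),\phi)$: $$\|f-\sigma_N^\circ(f\phi,\mu_N,\nu_N,B)\|_{L_p(B')}\le c\,r\,N^{-s},\qquad\|f\phi-\sigma_N^\circ(f\phi,\mu_N,\nu_N,\mathbb X)\|_{L_p(\mathbb X)}\le c\,r\,N^{-s},$$ and, if $\varepsilon:=c\,r\,N^{-s}$ satisfies $\varepsilon\le1$ and $\varepsilon\le r$, then the total number of bits of the integers $I_N(f\phi,\mu_N,y)$,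 $y\in\operatorname{supp}\nu_N$, is at most $$C\,(r/\varepsilon)^{\alpha/s}\,(1+\log_2(r/\varepsilon)).$$ -/

import Mathlib

open MeasureTheory Set Filter Topology
open scoped ENNReal

namespace DiffusionSpace

variable {X : Type*}

/-- A (symmetric) quasi-metric: a metric whose triangle inequality holds up to a constant. -/
structure IsQuasiMetric (ρ : X → X → ℝ) : Prop where
  nonneg : ∀ x y, 0 ≤ ρ x y
  eq_zero_iff : ∀ x y, ρ x y = 0 ↔ x = y
  symm : ∀ x y, ρ x y = ρ y x
  quasi_triangle : ∃ κ : ℝ, 1 ≤ κ ∧ ∀ x y z, ρ x z ≤ κ * (ρ x y + ρ y z)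

/-- The closed ball `B_t(x)`. -/
def cball (ρ : X → X → ℝ) (x : X) (t : ℝ) : Set X := {y | ρ x y ≤ t}

/-- The generalized heat kernel `G_t(x, y) = ∑ₖ exp(-λₖ² t) φₖ(x) φₖ(y)`. -/
noncomputable def heatKernel (lam : ℕ → ℝ) (φ : ℕ → X → ℝ) (t : ℝ) (x y : X) : ℝ :=
  ∑' k, Real.exp (-(lam k) ^ 2 * t) * φ k x * φ k y

/-- `(X, ρ, μ)` with the orthonormal basis `φₖ` and the frequencies `λₖ` is a diffusion measure
space of exponent `α`. The topology is the one of the quasi-metric. -/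
structure IsDiffusionMeasureSpace [TopologicalSpace X] [MeasurableSpace X] [BorelSpace X]
    (ρ : X → X → ℝ) (μ : Measure X) [IsProbabilityMeasure μ] (lam : ℕ → ℝ) (φ : ℕ → X → ℝ) (α : ℝ) : Prop where
  quasiMetric : IsQuasiMetric ρ
  isOpen_iff : ∀ U : Set X, IsOpen U ↔ ∀ x ∈ U, ∃ t : ℝ, 0 < t ∧ {y | ρ x y < t} ⊆ U
  continuous_phi : ∀ k, Continuous (φ k)
  phi_zero : ∀ x, φ 0 x = 1
  basis : ∃ b : HilbertBasis ℕ ℝ (Lp ℝ 2 μ), ∀ k, ⇑(b k) =ᵐ[μ] φ k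
  lam_zero : lam 0 = 0
  lam_mono : Monotone lam
  lam_tendsto : Tendsto lam atTop atTop
  alpha_pos : 0 < α
  isCompact_cball : ∀ x t, 0 < t → IsCompact (cball ρ x t)
  volume_le : ∃ C : ℝ, 0 < C ∧ ∀ x t, 0 < t → μ.real (cball ρ x t) ≤ C * t ^ α
  heat_upper : ∃ C c : ℝ, 0 < C ∧ 0 < c ∧ ∀ x y t, 0 < t → t ≤ 1 →
    |heatKernel lam φ t x y| ≤ C * t ^ (-α / 2) * Real.exp (-c * (ρ x y) ^ 2 / t)
  heat_lower : ∃ c : ℝ, 0 < c ∧ ∀ x t, 0 < t → t < 1 →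
    c * t ^ (-α / 2) ≤ heatKernel lam φ t x x

/-- The space `Π_N = span {φₖ : λₖ ≤ N}` of diffusion polynomials of degree at most `N`. -/
def diffPoly (lam : ℕ → ℝ) (φ : ℕ → X → ℝ) (N : ℝ) : Submodule ℝ (X → ℝ) :=
  Submodule.span ℝ (φ '' {k | lam k ≤ N})

/-- The product assumption with constant `a`, in the normalisation in which quadrature on
`Π_{aN}` integrates the products of elements of `Π_N` and of `Π_{2N}` (`N = 2 ^ n`). -/
def StrongProduct (lam : ℕ → ℝ) (φ : ℕ → X → ℝ) (a : ℝ) : Prop :=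
  0 < a ∧ ∀ n : ℕ, ∀ f ∈ diffPoly lam φ ((2 : ℝ) ^ n), ∀ g ∈ diffPoly lam φ (2 * (2 : ℝ) ^ n),
    f * g ∈ diffPoly lam φ (a * (2 : ℝ) ^ n)

/-- A low-pass filter; only the values on `[0, ∞)` matter. -/
structure IsLowPass (H : ℝ → ℝ) : Prop where
  smooth : ContDiffOn ℝ (⊤ : ℕ∞) H (Ici 0)
  antitone : AntitoneOn H (Ici 0)
  eq_one : ∀ t, 0 ≤ t → t ≤ 1 / 2 → H t = 1
  eq_zero : ∀ t, 1 ≤ t → H t = 0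

section Measure

variable [MeasurableSpace X]

/-- `ν` is a quadrature measure of order `N`: it integrates `Π_{aN}` exactly. -/
def IsQuadrature (μ : Measure X) (lam : ℕ → ℝ) (φ : ℕ → X → ℝ) (a N : ℝ)
    (ν : SignedMeasure X) : Prop :=
  ∀ P ∈ diffPoly lam φ (a * N), ∫ x, P x ∂μ = ∫ᵛ x, P x ∂•ν

/-- `(ν n)`, with `ν n` of order `N = 2 ^ n`, is a uniform family of Marcinkiewicz-Zygmund
quadrature measures for the exponent `p`. For `p = ∞` the two-sided sup-norm comparison alone puts
no bound on the size of `|ν n|`, so that the `L₁` upper bound is part of the notion. -/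
def IsUniformMZQuadrature (μ : Measure X) (lam : ℕ → ℝ) (φ : ℕ → X → ℝ) (a : ℝ) (p : ℝ≥0∞)
    (ν : ℕ → SignedMeasure X) : Prop :=
  (∀ n, IsQuadrature μ lam φ a ((2 : ℝ) ^ n) (ν n)) ∧
  ∃ c C : ℝ, 0 < c ∧ 0 < C ∧ ∀ n, ∀ P ∈ diffPoly lam φ (a * (2 : ℝ) ^ n),
    ENNReal.ofReal c * eLpNorm P p μ ≤ eLpNorm P p (ν n).totalVariation ∧
    eLpNorm P p (ν n).totalVariation ≤ ENNReal.ofReal C * eLpNorm P p μ ∧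
    (p = ∞ → eLpNorm P 1 (ν n).totalVariation ≤ ENNReal.ofReal C * eLpNorm P 1 μ)

/-- The error `E(f, Π_N, L_p)` of best approximation by diffusion polynomials. -/
noncomputable def bestError (μ : Measure X) (lam : ℕ → ℝ) (φ : ℕ → X → ℝ) (p : ℝ≥0∞)
    (f : X → ℝ) (N : ℝ) : ℝ≥0∞ :=
  ⨅ P ∈ diffPoly lam φ N, eLpNorm (f - P) p μ

/-- The global Sobolev norm `‖f‖_p + sup_N N^s E(f, Π_N, L_p)`, `N = 2 ^ n`. -/
noncomputable def sobolevNorm (μ : Measure X) (lam : ℕ → ℝ) (φ : ℕ → X → ℝ) (p : ℝ≥0∞) (s : ℝ)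
    (f : X → ℝ) : ℝ≥0∞ :=
  eLpNorm f p μ +
    ⨆ n : ℕ, ENNReal.ofReal (((2 : ℝ) ^ n) ^ s) * bestError μ lam φ p f ((2 : ℝ) ^ n)

/-- The norm `‖f‖_p + sup_N N^s E(f ψ, Π_N, L_p)`, `N = 2 ^ n`, of `W^s(L_p(X), ψ)`. -/
noncomputable def cutoffSobolevNorm (μ : Measure X) (lam : ℕ → ℝ) (φ : ℕ → X → ℝ) (p : ℝ≥0∞)
    (s : ℝ) (ψ f : X → ℝ) : ℝ≥0∞ :=
  eLpNorm f p μ +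
    ⨆ n : ℕ, ENNReal.ofReal (((2 : ℝ) ^ n) ^ s) * bestError μ lam φ p (f * ψ) ((2 : ℝ) ^ n)

section Topology

variable [TopologicalSpace X]

/-- `X_p`, the `L_p`-closure of the diffusion polynomials; the elements of `X_∞` are represented
by continuous functions. -/
def closurePoly (μ : Measure X) (lam : ℕ → ℝ) (φ : ℕ → X → ℝ) (p : ℝ≥0∞) : Set (X → ℝ) :=
  {f | MemLp f p μ ∧ (p = ∞ → Continuous f) ∧
    ∀ δ : ℝ, 0 < δ → ∃ n : ℕ, ∃ P ∈ diffPoly lam φ ((2 : ℝ) ^ n),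
      eLpNorm (f - P) p μ ≤ ENNReal.ofReal δ}

/-- `C^∞(X) = ⋂_{s > 0} W^s(L_∞(X))`; the elements are represented by continuous functions. -/
def smoothFunctions (μ : Measure X) (lam : ℕ → ℝ) (φ : ℕ → X → ℝ) : Set (X → ℝ) :=
  {ψ | Continuous ψ ∧ ∀ s : ℝ, 0 < s → sobolevNorm μ lam φ ∞ s ψ < ∞}

/-- The ball of radius `r` of `W^s(L_p(X), ψ)`. -/
def cutoffSobolevBall (μ : Measure X) (lam : ℕ → ℝ) (φ : ℕ → X → ℝ) (p : ℝ≥0∞) (s : ℝ)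
    (ψ : X → ℝ) (r : ℝ) : Set (X → ℝ) :=
  {f | f ∈ closurePoly μ lam φ p ∧ cutoffSobolevNorm μ lam φ p s ψ f ≤ ENNReal.ofReal r}

end Topology

/-- `σ_N(f, ν)(x) = ∑ₖ H(λₖ / N) (∫ f φₖ dν) φₖ(x)`, a finite sum. -/
noncomputable def sigma (lam : ℕ → ℝ) (φ : ℕ → X → ℝ) (H : ℝ → ℝ) (N : ℝ)
    (f : X → ℝ) (ν : SignedMeasure X) (x : X) : ℝ :=
  ∑' k, H (lam k / N) * (∫ᵛ y, f y * φ k y ∂•ν) * φ k x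

/-- `K_N(x, y) = ∑ₖ H(λₖ / (2N)) φₖ(x) φₖ(y)`, a finite sum. -/
noncomputable def kernelK (lam : ℕ → ℝ) (φ : ℕ → X → ℝ) (H : ℝ → ℝ) (N : ℝ) (x y : X) : ℝ :=
  ∑' k, H (lam k / (2 * N)) * φ k x * φ k y

/-- The quantization `I_N(f, ν, y) = ⌊N^S σ_N(f, ν, y)⌋`. -/
noncomputable def quantize (lam : ℕ → ℝ) (φ : ℕ → X → ℝ) (H : ℝ → ℝ) (S N : ℝ)
    (f : X → ℝ) (ν : SignedMeasure X) (y : X) : ℤ :=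
  ⌊N ^ S * sigma lam φ H N f ν y⌋

/-- The reconstruction `σ°_N(f, μ_N, ν_N, B)(x) = N^{-S} ∫_B I_N(f, μ_N, y) K_N(x, y) dν_N(y)`. -/
noncomputable def sigmaCirc (lam : ℕ → ℝ) (φ : ℕ → X → ℝ) (H : ℝ → ℝ) (S N : ℝ)
    (f : X → ℝ) (μN νN : SignedMeasure X) (B : Set X) (x : X) : ℝ :=
  N ^ (-S) * ∫ᵛ y in B, (quantize lam φ H S N f μN y : ℝ) * kernelK lam φ H N x y ∂•νN

end Measure

/-- The number of bits of an integer: the binary digits of `|m|` and one bit for the sign. -/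
def bitLength (m : ℤ) : ℕ := m.natAbs.size + 1

/-- The number of bits that represent all the integers `I y`, `y ∈ A` (for finite `A`). -/
noncomputable def totalBits (A : Set X) (I : X → ℤ) : ℕ := ∑ᶠ y ∈ A, bitLength (I y)

end DiffusionSpace

/-! ### Rapidly convergent Chebyshev series on `[0, 1]` -/

namespace DiffusionSpace

/-! Everything rests on the localization of the kernels `K_M(x, y) = ∑ₖ H(λₖ / M) φₖ(x) φₖ(y)`: for
every `m`, `|K_M(x, y)| ≤ C M^α (1 + M min(ρ(x, y), 1))⁻ᵐ`. To get this from the Gaussian bound, put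
`u = exp(-λ² / M²)` and write `H(λ / M) = h(u) u` with `h` smooth on `[0, 1]`. The Chebyshev series
of `h` converges faster than any power. The term of degree `n` is a combination of heat kernels at
the times `(j + 1) / M²`, `j ≤ n`. If `n` is small against `M min(ρ, 1)`, the Gaussian decay beats
the coefficients of the Chebyshev polynomial; otherwise `|T_n| ≤ 1` suffices and the lost factor `(1
+ n)^m` is paid by the Chebyshev coefficients of `h` (`exists_abs_filterKernel_le`).

An upper Marcinkiewicz-Zygmund inequality, tested on the kernels themselves, shows that `|ν_N|`
gives the weight at scale `1 / N` around any point a mass `O(N^{-α})`, as `μ` does. Hence the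
kernels of order `N` and `2N` have bounded `L₁(|ν_N|)` norms (`exists_lintegral_kernel_le`).

Consequently `σ_N` is bounded on `L_p`. By quadrature and the product assumption it reproduces
`Π_{N/2}`, so `P = σ_N(fψ)` approximates `fψ` to the order `r N^{-s}` (`exists_approx`). In the same
way `K_{2N}` and `ν_N` reproduce `P ∈ Π_N` from its values on the support of `ν_N`. Rounding moves
these values by at most `N^{-S}`, and the bounded kernel norms turn this into an error `O(N^{-S})`.
Dropping the nodes outside `B` changes the result on `B'` by a negligible amount, since `B'` has
positive distance from the complement of `B` and the kernels decay faster than the growth `|P| ≤ C r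
N^α` (`exists_quantization_error_le`).

For the bits, `ε ≤ 1` bounds `r` by a multiple of `N^s`, so each integer is at most a power of `N`
up to a constant and costs `O(1 + log N)` bits. There are `O(N^α)` nodes, and `N^s = c r / ε`. -/

open Polynomial in
/-- The Chebyshev polynomials of the interval `[0, 1]`, `q n ((1 + cos θ) / 2) = cos (n θ)`. -/
noncomputable def shiftedCheb : ℕ → ℝ[X]
  | 0 => 1
  | 1 => 2 * X - 1
  | n + 2 => 2 * (2 * X - 1) * shiftedCheb (n + 1) - shiftedCheb n

theorem shiftedCheb_eval (θ : ℝ) (n : ℕ) :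
    (shiftedCheb n).eval ((1 + Real.cos θ) / 2) = Real.cos (n * θ) := by
  induction n using shiftedCheb.induct with
  | case1 => simp [shiftedCheb]
  | case2 => simp [shiftedCheb]; ring
  | case3 n h1 h0 =>
    have h : Real.cos (((n + 2 : ℕ) : ℝ) * θ) =
        2 * Real.cos θ * Real.cos (((n + 1 : ℕ) : ℝ) * θ) - Real.cos (n * θ) := by
      have e1 : ((n + 2 : ℕ) : ℝ) * θ = ((n + 1 : ℕ) : ℝ) * θ + θ := by push_cast; ring
      have e2 : (n : ℝ) * θ = ((n + 1 : ℕ) : ℝ) * θ - θ := by push_cast; ring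
      rw [e1, e2, Real.cos_add, Real.cos_sub]; ring
    rw [h, ← h1, ← h0]
    simp only [shiftedCheb, Polynomial.eval_sub, Polynomial.eval_mul, Polynomial.eval_ofNat,
      Polynomial.eval_X, Polynomial.eval_one]
    ring

theorem shiftedCheb_natDegree_le (n : ℕ) : (shiftedCheb n).natDegree ≤ n := by
  induction n using shiftedCheb.induct with
  | case1 => simp [shiftedCheb]
  | case2 => rw [shiftedCheb]; compute_degree
  | case3 n h1 h0 =>
    rw [shiftedCheb]
    refine (Polynomial.natDegree_sub_le _ _).trans (max_le ?_ (by omega))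
    refine Polynomial.natDegree_mul_le.trans ?_
    have : (2 * (2 * Polynomial.X - 1) : Polynomial ℝ).natDegree ≤ 1 := by compute_degree
    omega

/-- The recurrence `q (n + 2) = 4 x q (n + 1) - 2 q (n + 1) - q n` bounds the next sum by `6 · 7^(n
+ 1) + 7^n ≤ 7^(n + 2)`. Exponential growth is harmless, as it will be set against Gaussian decay.
-/
theorem sum_abs_coeff_shiftedCheb_le (n M : ℕ) :
    ∑ j ∈ Finset.range M, |(shiftedCheb n).coeff j| ≤ 7 ^ n := by
  induction n using shiftedCheb.induct generalizing M with
  | case1 =>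
    simp only [shiftedCheb, Polynomial.coeff_one, pow_zero]
    rcases M with _ | M
    · simp
    · rw [Finset.sum_range_succ']; simp
  | case2 =>
    have h : ∀ j, |(2 * Polynomial.X - 1 : Polynomial ℝ).coeff j| ≤
        2 * (if j = 1 then 1 else 0) + (if j = 0 then 1 else 0) := by
      intro j
      have : (2 * Polynomial.X - 1 : Polynomial ℝ) =
        Polynomial.C 2 * Polynomial.X - Polynomial.C 1 := by rw [map_one]; rfl
      rw [this, Polynomial.coeff_sub, Polynomial.coeff_C_mul, Polynomial.coeff_X,
        Polynomial.coeff_C]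
      rcases j with _ | _ | j <;> simp
    rw [shiftedCheb]
    refine (Finset.sum_le_sum fun j _ => h j).trans ?_
    rw [Finset.sum_add_distrib, ← Finset.mul_sum, Finset.sum_ite_eq', Finset.sum_ite_eq']
    split_ifs <;> norm_num
  | case3 n h1 h0 =>
    have e : shiftedCheb (n + 2) = Polynomial.C 4 * (Polynomial.X * shiftedCheb (n + 1)) -
        Polynomial.C 2 * shiftedCheb (n + 1) - shiftedCheb n := by
      have c4 : (Polynomial.C 4 : Polynomial ℝ) = 4 := rfl
      have c2 : (Polynomial.C 2 : Polynomial ℝ) = 2 := rfl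
      rw [shiftedCheb, c4, c2]; ring
    have hX : ∑ j ∈ Finset.range M, |(Polynomial.X * shiftedCheb (n + 1)).coeff j| ≤
        7 ^ (n + 1) := by
      rcases M with _ | M
      · simp
      · rw [Finset.sum_range_succ']
        simpa [Polynomial.coeff_X_mul] using h1 M
    have hj : ∀ j, |(shiftedCheb (n + 2)).coeff j| ≤
        4 * |(Polynomial.X * shiftedCheb (n + 1)).coeff j| +
        2 * |(shiftedCheb (n + 1)).coeff j| + |(shiftedCheb n).coeff j| := by
      intro j
      rw [e, Polynomial.coeff_sub, Polynomial.coeff_sub, Polynomial.coeff_C_mul,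
        Polynomial.coeff_C_mul]
      refine (abs_sub _ _).trans (add_le_add ((abs_sub _ _).trans ?_) le_rfl)
      rw [abs_mul, abs_mul]; norm_num
    refine (Finset.sum_le_sum fun j _ => hj j).trans ?_
    rw [Finset.sum_add_distrib, Finset.sum_add_distrib, ← Finset.mul_sum, ← Finset.mul_sum]
    have := h1 M
    have := h0 M
    have : (0 : ℝ) < 7 ^ n := by positivity
    rw [pow_succ] at *
    rw [pow_succ]
    linarith

/-- Rapid decay of the Fourier coefficients of a smooth periodic function. -/
theorem exists_norm_fourierCoeffOn_le (m : ℕ) (f : ℝ → ℂ) (hf : ContDiff ℝ (⊤ : ℕ∞) f)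
    (hper : Function.Periodic f (2 * Real.pi)) :
    ∃ C : ℝ, ∀ n : ℤ, n ≠ 0 →
      ‖fourierCoeffOn Real.two_pi_pos f n‖ * |(n : ℝ)| ^ m ≤ C := by
  induction m generalizing f with
  | zero =>
    refine ⟨|1 / (2 * Real.pi - 0)| * (∫ x in (0 : ℝ)..(2 * Real.pi), ‖f x‖), fun n _ => ?_⟩
    rw [fourierCoeffOn_eq_integral, norm_smul, pow_zero, mul_one, Real.norm_eq_abs]
    gcongr
    refine (intervalIntegral.norm_integral_le_integral_norm Real.two_pi_pos.le).trans
      (le_of_eq ?_)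
    refine intervalIntegral.integral_congr fun x _ => ?_
    simp only [norm_smul, fourier_apply, Circle.norm_coe, one_mul]
  | succ m ih =>
    have hd : ContDiff ℝ (⊤ : ℕ∞) (deriv f) := (contDiff_infty_iff_deriv.1 hf).2
    have hD : Differentiable ℝ f := (contDiff_infty_iff_deriv.1 hf).1
    have hp' : Function.Periodic (deriv f) (2 * Real.pi) := by
      intro x
      rw [← deriv_comp_add_const]
      congr 1
      funext y
      exact hper y
    obtain ⟨C, hC⟩ := ih (deriv f) hd hp'
    refine ⟨C, fun n hn => ?_⟩
    refine le_trans (le_of_eq ?_) (hC n hn)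
    have key := fourierCoeffOn_of_hasDerivAt Real.two_pi_pos hn (f := f) (f' := deriv f)
      (fun x _ => (hD x).hasDerivAt) (hd.continuous.intervalIntegrable _ _)
    -- Periodicity kills the boundary term of the integration by parts, so each derivative gains one
    -- factor `1 / |n|`.
    have h0 : f (2 * Real.pi) - f 0 = 0 := by
      have := hper 0
      rw [zero_add] at this
      rw [this, sub_self]
    rw [h0, mul_zero, zero_sub] at key
    have hn' : |(n : ℝ)| ≠ 0 := by simpa using hn
    have hnorm : ‖fourierCoeffOn Real.two_pi_pos f n‖ =
        ‖fourierCoeffOn Real.two_pi_pos (deriv f) n‖ / |(n : ℝ)| := by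
      rw [key, norm_mul, norm_neg, norm_mul, norm_div, norm_mul, norm_mul, norm_mul]
      have : ‖(n : ℂ)‖ = |(n : ℝ)| := by
        rw [← Complex.ofReal_intCast, Complex.norm_real, Real.norm_eq_abs]
      rw [this]
      have hpi := Real.pi_pos
      simp [abs_of_pos hpi, ← Complex.ofReal_ofNat]
      field_simp
    rw [hnorm, pow_succ]
    field_simp

theorem summable_int_inv_one_add_sq : Summable fun n : ℤ => ((1 + |(n : ℝ)|) ^ 2)⁻¹ := by
  have h1 : Summable fun n : ℤ => 1 / |(n : ℝ)| ^ (2 : ℝ) :=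
    (Real.summable_one_div_int_add_rpow 0 2).2 (by norm_num) |>.congr (by simp)
  have h2 : Summable fun n : ℤ => 1 / |(n : ℝ)| ^ (2 : ℝ) + (if n = 0 then (1 : ℝ) else 0) :=
    h1.add (summable_of_ne_finset_zero (s := {0}) (by intro b hb; simpa using hb))
  refine h2.of_nonneg_of_le (fun n => by positivity) fun n => ?_
  by_cases hn : n = 0
  · subst hn; simp
  · have hp : 0 < |(n : ℝ)| := by simpa using hn
    simp only [hn, if_false, add_zero, Real.rpow_two, one_div]
    gcongr
    linarith

/-- A smooth function on `[0, 1]` is a rapidly convergent series of Chebyshev polynomials. -/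
theorem exists_shiftedCheb_expansion {G : ℝ → ℝ}
    (hG : ∀ u ∈ Icc (0 : ℝ) 1, ContDiffAt ℝ (⊤ : ℕ∞) G u) :
    ∃ c : ℤ → ℝ, (∀ m : ℕ, Summable fun n : ℤ => |c n| * (1 + |(n : ℝ)|) ^ m) ∧
      ∀ u ∈ Icc (0 : ℝ) 1, HasSum (fun n : ℤ => c n * (shiftedCheb n.natAbs).eval u) (G u) := by
  -- In the variable `u = (1 + cos θ) / 2` the function becomes smooth, even and periodic, and its
  -- cosine series is the Chebyshev series.
  set g : ℝ → ℂ := fun θ => ((G ((1 + Real.cos θ) / 2) : ℝ) : ℂ) with hg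
  have hgs : ContDiff ℝ (⊤ : ℕ∞) g := by
    refine Complex.ofRealCLM.contDiff.comp (contDiff_iff_contDiffAt.2 fun θ => ?_)
    refine ContDiffAt.comp θ (hG _ ⟨?_, ?_⟩) ?_
    · linarith [Real.neg_one_le_cos θ]
    · linarith [Real.cos_le_one θ]
    · exact ((contDiff_const.add Real.contDiff_cos).div_const _).contDiffAt
  have hper : Function.Periodic g (2 * Real.pi) := by
    intro θ; simp [hg, Real.cos_add_two_pi]
  have : Fact (0 < 2 * Real.pi) := ⟨Real.two_pi_pos⟩
  have hcont : Continuous (AddCircle.liftIco (2 * Real.pi) 0 g) := by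
    refine AddCircle.liftIco_continuous ?_ hgs.continuous.continuousOn
    exact (hper 0).symm
  set F : C(AddCircle (2 * Real.pi), ℂ) := ⟨_, hcont⟩ with hF
  have hcoef : ∀ n, fourierCoeff F n = fourierCoeffOn Real.two_pi_pos g n := by
    intro n
    have := fourierCoeff_liftIco_eq (T := 2 * Real.pi) (a := 0) g n
    simp only [hF, ContinuousMap.coe_mk]
    rw [this]
    simp only [zero_add]
  have hdecay : ∀ m : ℕ, Summable fun n : ℤ => ‖fourierCoeff F n‖ * (1 + |(n : ℝ)|) ^ m := by
    intro m
    obtain ⟨C, hC⟩ := exists_norm_fourierCoeffOn_le (m + 2) g hgs hper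
    -- The power `m + 2` leaves a summable `(1 + |n|)⁻²`. The decay estimate excludes `n = 0`;
    -- elsewhere `1 + |n| ≤ 2 |n|`, whence the factor `2 ^ (m + 2)`.
    set D := max (‖fourierCoeff F 0‖) (2 ^ (m + 2) * C)
    refine (summable_int_inv_one_add_sq.mul_left D).of_nonneg_of_le
      (fun n => by positivity) fun n => ?_
    have hp : 0 < 1 + |(n : ℝ)| := by positivity
    rw [← div_eq_mul_inv, le_div_iff₀ (by positivity), mul_assoc, ← pow_add]
    by_cases hn : n = 0
    · subst hn; simp [D]
    · refine le_trans ?_ (le_max_right _ _)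
      have h1 : 1 ≤ |(n : ℝ)| := by
        have := Int.one_le_abs hn
        exact_mod_cast this
      calc ‖fourierCoeff F n‖ * (1 + |(n : ℝ)|) ^ (m + 2)
          ≤ ‖fourierCoeff F n‖ * (2 * |(n : ℝ)|) ^ (m + 2) := by gcongr; linarith
        _ = 2 ^ (m + 2) * (‖fourierCoeffOn Real.two_pi_pos g n‖ * |(n : ℝ)| ^ (m + 2)) := by
          rw [hcoef, mul_pow]; ring
        _ ≤ _ := by gcongr; exact hC n hn
  refine ⟨fun n => (fourierCoeff F n).re, fun m => ?_, fun u hu => ?_⟩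
  · refine (hdecay m).of_nonneg_of_le (fun n => by positivity) fun n => ?_
    gcongr
    exact Complex.abs_re_le_norm _
  · have hs : Summable (fourierCoeff F) := by
      refine Summable.of_norm ?_
      simpa using hdecay 0
    set θ := Real.arccos (2 * u - 1)
    have hcos : Real.cos θ = 2 * u - 1 := Real.cos_arccos (by linarith [hu.1]) (by linarith [hu.2])
    have hu' : u = (1 + Real.cos θ) / 2 := by rw [hcos]; ring
    have hFθ : ∀ θ : ℝ, F (θ : AddCircle (2 * Real.pi)) = g θ := by
      intro θ
      obtain ⟨k, hk, -⟩ := existsUnique_sub_zsmul_mem_Ico Real.two_pi_pos θ 0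
      rw [← hper.sub_zsmul_eq k, ← AddCircle.liftIco_coe_apply (p := 2 * Real.pi) (f := g) hk,
        AddCircle.coe_sub, AddCircle.coe_zsmul, AddCircle.coe_period, smul_zero, sub_zero]
      rfl
    have key : ∀ θ : ℝ, HasSum (fun n : ℤ => fourierCoeff F n *
        Complex.exp ((n * θ : ℝ) * Complex.I)) (g θ) := by
      intro θ
      have := has_pointwise_sum_fourier_series_of_summable hs (θ : AddCircle (2 * Real.pi))
      rw [hFθ] at this
      convert this using 2 with n
      rw [smul_eq_mul, fourier_coe_apply]
      congr 2
      have : (Real.pi : ℂ) ≠ 0 := by exact_mod_cast Real.pi_ne_zero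
      push_cast
      field_simp
    have hneg : g (-θ) = g θ := by simp [hg]
    -- Averaging over `±θ` and taking real parts turns each term into `Re(c n) cos (n θ)`, without
    -- having to show that the Fourier coefficients are real or even.
    have hsum := (key θ).add (key (-θ))
    rw [hneg] at hsum
    have hre := (Complex.hasSum_re hsum).div_const 2
    have hgu : (g θ + g θ).re / 2 = G u := by simp [hg, ← hu']
    rw [hgu] at hre
    refine hre.congr_fun fun n => ?_
    have hn : (shiftedCheb n.natAbs).eval u = Real.cos (n * θ) := by
      rw [hu', shiftedCheb_eval]
      rcases abs_choice (n : ℝ) with h | h <;>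
      simp [Nat.cast_natAbs, h]
    rw [hn]
    simp only [Complex.add_re, Complex.mul_re, Complex.exp_ofReal_mul_I_re,
      Complex.exp_ofReal_mul_I_im]
    simp only [mul_neg, Real.cos_neg, Real.sin_neg]
    ring

end DiffusionSpace

/-! ### Topology and measurability of the quasi-metric -/

namespace DiffusionSpace

section QuasiMetricTopology

variable {X : Type*} [TopologicalSpace X] {ρ : X → X → ℝ}

/-- The balls of a quasi-metric need not be open. The set of centres of balls contained in the given
one is open, since the radius `s / (2κ)` can be used twice inside a ball of radius `s`. -/
theorem ball_mem_nhds (hρ : IsQuasiMetric ρ)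
    (ho : ∀ U : Set X, IsOpen U ↔ ∀ x ∈ U, ∃ t : ℝ, 0 < t ∧ {y | ρ x y < t} ⊆ U)
    (x : X) {t : ℝ} (ht : 0 < t) : {y | ρ x y < t} ∈ 𝓝 x := by
  obtain ⟨κ, hκ, htri⟩ := hρ.quasi_triangle
  have hself : ∀ y, ρ y y = 0 := fun y => (hρ.eq_zero_iff y y).2 rfl
  refine mem_nhds_iff.2 ⟨{y | ∃ s : ℝ, 0 < s ∧ {z | ρ y z < s} ⊆ {z | ρ x z < t}}, ?_, ?_, ?_⟩
  · rintro y ⟨s, hs, hy⟩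
    exact hy (by simpa [hself] using hs)
  · refine (ho _).2 ?_
    rintro y ⟨s, hs, hy⟩
    refine ⟨s / (2 * κ), by positivity, fun z hz => ⟨s / (2 * κ), by positivity, fun w hw => ?_⟩⟩
    refine hy ?_
    simp only [mem_ofPred_eq] at hz hw ⊢
    calc ρ y w ≤ κ * (ρ y z + ρ z w) := htri _ _ _
      _ < κ * (s / (2 * κ) + s / (2 * κ)) := by gcongr
      _ = s := by field_simp; norm_num
  · exact ⟨t, ht, subset_rfl⟩

theorem t2Space_of_isQuasiMetric (hρ : IsQuasiMetric ρ)
    (ho : ∀ U : Set X, IsOpen U ↔ ∀ x ∈ U, ∃ t : ℝ, 0 < t ∧ {y | ρ x y < t} ⊆ U) :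
    T2Space X := by
  obtain ⟨κ, hκ, htri⟩ := hρ.quasi_triangle
  refine t2Space_iff_disjoint_nhds.2 fun x y hxy => ?_
  have hpos : 0 < ρ x y :=
    lt_of_le_of_ne (hρ.nonneg x y) fun h => hxy ((hρ.eq_zero_iff x y).1 h.symm)
  have hr : 0 < ρ x y / (2 * κ) := by positivity
  refine Filter.disjoint_iff.2 ⟨_, ball_mem_nhds hρ ho x hr, _, ball_mem_nhds hρ ho y hr, ?_⟩
  refine Set.disjoint_left.2 fun z hz hz' => ?_
  simp only [mem_ofPred_eq] at hz hz'
  rw [hρ.symm y z] at hz'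
  have : ρ x y < ρ x y := by
    calc ρ x y ≤ κ * (ρ x z + ρ z y) := htri _ _ _
      _ < κ * (ρ x y / (2 * κ) + ρ x y / (2 * κ)) := by gcongr
      _ = ρ x y := by field_simp; norm_num
  exact lt_irrefl _ this

/-- A continuous function that is nonzero on a compact set stays nonzero on a uniform
neighbourhood of it. -/
theorem exists_forall_ne_zero_of_lt (hρ : IsQuasiMetric ρ)
    (ho : ∀ U : Set X, IsOpen U ↔ ∀ x ∈ U, ∃ t : ℝ, 0 < t ∧ {y | ρ x y < t} ⊆ U)
    {K : Set X} (hK : IsCompact K) {ψ : X → ℝ} (hψ : Continuous ψ) (h0 : ∀ x ∈ K, ψ x ≠ 0) :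
    ∃ δ : ℝ, 0 < δ ∧ ∀ x ∈ K, ∀ y, ρ x y < δ → ψ y ≠ 0 := by
  obtain ⟨κ, hκ, htri⟩ := hρ.quasi_triangle
  refine hK.induction_on (p := fun s => ∃ δ : ℝ, 0 < δ ∧ ∀ x ∈ s, ∀ y, ρ x y < δ → ψ y ≠ 0)
    ⟨1, one_pos, by simp⟩ ?_ ?_ ?_
  · rintro s t hst ⟨δ, hδ, h⟩
    exact ⟨δ, hδ, fun x hx => h x (hst hx)⟩
  · rintro s t ⟨δ, hδ, h⟩ ⟨δ', hδ', h'⟩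
    refine ⟨min δ δ', lt_min hδ hδ', ?_⟩
    rintro x (hx | hx) y hy
    · exact h x hx y (hy.trans_le (min_le_left _ _))
    · exact h' x hx y (hy.trans_le (min_le_right _ _))
  · intro x hx
    obtain ⟨t, ht, hsub⟩ := (ho _).1 (isOpen_ne.preimage hψ : IsOpen (ψ ⁻¹' {0}ᶜ)) x (h0 x hx)
    have hr : 0 < t / (2 * κ) := by positivity
    refine ⟨_, mem_nhdsWithin_of_mem_nhds (ball_mem_nhds hρ ho x hr), _, hr, fun z hz y hy => ?_⟩
    simp only [mem_ofPred_eq] at hz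
    refine hsub ?_
    calc ρ x y ≤ κ * (ρ x z + ρ z y) := htri _ _ _
      _ < κ * (t / (2 * κ) + t / (2 * κ)) := by gcongr
      _ = t := by field_simp; norm_num

end QuasiMetricTopology

section Measurability

variable {X : Type*} [TopologicalSpace X] [MeasurableSpace X] [BorelSpace X]
  {ρ : X → X → ℝ} {μ : Measure X} [IsProbabilityMeasure μ] {lam : ℕ → ℝ} {φ : ℕ → X → ℝ} {α : ℝ}

theorem IsDiffusionMeasureSpace.t2Space (hX : IsDiffusionMeasureSpace ρ μ lam φ α) : T2Space X :=
  t2Space_of_isQuasiMetric hX.quasiMetric hX.isOpen_iff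

theorem IsDiffusionMeasureSpace.measurableSet_cball (hX : IsDiffusionMeasureSpace ρ μ lam φ α)
    (x : X) {t : ℝ} (ht : 0 < t) : MeasurableSet (cball ρ x t) :=
  have := hX.t2Space
  (hX.isCompact_cball x t ht).isClosed.measurableSet

/-- Continuity of `ρ x` is not available; but its sublevel sets are empty, a point, or a compact
ball, hence closed in a Hausdorff space. -/
theorem IsDiffusionMeasureSpace.measurable_dist (hX : IsDiffusionMeasureSpace ρ μ lam φ α)
    (x : X) : Measurable (ρ x) := by
  have := hX.t2Space
  refine measurable_of_Iic fun t => ?_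
  rcases lt_trichotomy t 0 with ht | rfl | ht
  · have : ρ x ⁻¹' Iic t = ∅ := by
      ext y
      simpa using ht.trans_le (hX.quasiMetric.nonneg x y)
    rw [this]; exact MeasurableSet.empty
  · have : ρ x ⁻¹' Iic 0 = {x} := by
      ext y
      simp only [mem_preimage, mem_Iic, mem_singleton_iff]
      constructor
      · intro h
        exact ((hX.quasiMetric.eq_zero_iff x y).1 (le_antisymm h (hX.quasiMetric.nonneg x y))).symm
      · rintro rfl
        exact ((hX.quasiMetric.eq_zero_iff y y).2 rfl).le
    rw [this]; exact measurableSet_singleton x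
  · exact hX.measurableSet_cball x ht

theorem IsDiffusionMeasureSpace.lam_nonneg (hX : IsDiffusionMeasureSpace ρ μ lam φ α) (k : ℕ) :
    0 ≤ lam k := hX.lam_zero ▸ hX.lam_mono (Nat.zero_le k)

theorem IsDiffusionMeasureSpace.finite_lam_le (hX : IsDiffusionMeasureSpace ρ μ lam φ α) (M : ℝ) :
    {k | lam k ≤ M}.Finite := by
  obtain ⟨n, hn⟩ := (hX.lam_tendsto.eventually_gt_atTop M).exists
  refine (Set.finite_lt_nat n).subset fun k hk => ?_
  by_contra h
  exact absurd (hX.lam_mono (not_lt.1 h)) (not_le.2 (lt_of_le_of_lt hk hn))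

end Measurability

end DiffusionSpace

/-! ### Localization of the filtered kernels -/

namespace DiffusionSpace

theorem abs_shiftedCheb_eval_le_one (n : ℕ) {u : ℝ} (hu : u ∈ Icc (0 : ℝ) 1) :
    |(shiftedCheb n).eval u| ≤ 1 := by
  have hcos : Real.cos (Real.arccos (2 * u - 1)) = 2 * u - 1 :=
    Real.cos_arccos (by linarith [hu.1]) (by linarith [hu.2])
  have hu' : u = (1 + Real.cos (Real.arccos (2 * u - 1))) / 2 := by rw [hcos]; ring
  rw [hu', shiftedCheb_eval]
  exact Real.abs_cos_le_one _

/-- The profile of a low-pass filter in the heat variable `u = exp (-t ^ 2)`, divided by `u`. -/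
noncomputable def heatProfile (H : ℝ → ℝ) (u : ℝ) : ℝ := H (Real.sqrt (-Real.log u)) * u⁻¹

/-- The singularities of `u⁻¹` at `0` and of the square root at `u = 1` are invisible: the profile
vanishes for `|u| < e⁻¹` because `H = 0` on `[1, ∞)`, and equals `u⁻¹` for `u > e^(-1/4)` because `H
= 1` on `[0, 1/2]`. In between it is a composition of smooth functions. -/
theorem IsLowPass.contDiffAt_heatProfile {H : ℝ → ℝ} (hH : IsLowPass H) {u : ℝ}
    (hu : u ∈ Icc (0 : ℝ) 1) : ContDiffAt ℝ (⊤ : ℕ∞) (heatProfile H) u := by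
  rcases lt_or_ge u (Real.exp (-1)) with h1 | h1
  · have hnear : ∀ᶠ v in 𝓝 u, heatProfile H v = 0 := by
      have : ∀ᶠ v in 𝓝 u, |v| < Real.exp (-1) := by
        have : |u| < Real.exp (-1) := by rwa [abs_of_nonneg hu.1]
        exact continuous_abs.continuousAt.eventually (gt_mem_nhds this)
      filter_upwards [this] with v hv
      by_cases hv0 : v = 0
      -- At `v = 0` the value is `0` by the convention `0⁻¹ = 0`. Negative `v` are covered below by
      -- `log v = log |v|`.
      · simp [heatProfile, hv0]
      · have : 1 ≤ Real.sqrt (-Real.log v) := by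
          rw [Real.one_le_sqrt, ← Real.log_abs]
          have := (Real.log_lt_iff_lt_exp (abs_pos.2 hv0)).2 hv
          linarith
        simp [heatProfile, hH.eq_zero _ this]
    exact (contDiffAt_const (c := (0 : ℝ))).congr_of_eventuallyEq hnear
  · have hu0 : 0 < u := (Real.exp_pos _).trans_le h1
    rcases lt_or_ge (Real.exp (-(1 / 4))) u with h2 | h2
    · have hnear : ∀ᶠ v in 𝓝 u, heatProfile H v = v⁻¹ := by
        filter_upwards [lt_mem_nhds h2] with v hv
        have hv0 : 0 < v := (Real.exp_pos _).trans hv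
        have : Real.sqrt (-Real.log v) ≤ 1 / 2 := by
          rw [Real.sqrt_le_left (by norm_num)]
          have := (Real.lt_log_iff_exp_lt hv0).2 hv
          linarith
        rw [heatProfile, hH.eq_one _ (Real.sqrt_nonneg _) this, one_mul]
      exact (contDiffAt_inv ℝ hu0.ne').congr_of_eventuallyEq hnear
    · have hlog : Real.log u < 0 := by
        have := (Real.log_le_iff_le_exp hu0).2 h2
        linarith
      have hpos : 0 < Real.sqrt (-Real.log u) := Real.sqrt_pos.2 (by linarith)
      refine ContDiffAt.mul ?_ (contDiffAt_inv ℝ hu0.ne')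
      refine ContDiffAt.comp u (f := fun u => Real.sqrt (-Real.log u))
        (hH.smooth.contDiffAt (Ici_mem_nhds hpos)) ?_
      exact (Real.contDiffAt_log.2 hu0.ne').neg.sqrt (by linarith)

theorem heatProfile_mul_exp (H : ℝ → ℝ) {l M : ℝ} (hl : 0 ≤ l) (hM : 0 < M) :
    heatProfile H (Real.exp (-l ^ 2 * (M ^ 2)⁻¹)) * Real.exp (-l ^ 2 * (M ^ 2)⁻¹) = H (l / M) := by
  rw [heatProfile, Real.log_exp, mul_assoc, inv_mul_cancel₀ (Real.exp_pos _).ne', mul_one]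
  congr 1
  rw [show -(-l ^ 2 * (M ^ 2)⁻¹) = (l / M) ^ 2 by field_simp]
  exact Real.sqrt_sq (by positivity)

theorem exp_neg_le_div_one_add_pow (m : ℕ) {v : ℝ} (hv : 0 ≤ v) :
    Real.exp (-v) ≤ (m.factorial * Real.exp 1) * ((1 + v) ^ m)⁻¹ := by
  have h := Real.pow_div_factorial_le_exp (1 + v) (by linarith) m
  rw [div_le_iff₀ (by positivity), Real.exp_add] at h
  rw [← div_eq_mul_inv, le_div_iff₀ (by positivity), Real.exp_neg, inv_mul_le_iff₀ (Real.exp_pos _)]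
  linarith

theorem seven_pow_le_exp (n : ℕ) : (7 : ℝ) ^ n ≤ Real.exp (2 * n) := by
  have : (7 : ℝ) ≤ Real.exp 2 := by
    have h := Real.exp_one_gt_d9
    rw [show (2 : ℝ) = 1 + 1 by norm_num, Real.exp_add]
    nlinarith
  rw [mul_comm, Real.exp_nat_mul]
  gcongr

section Kernel

variable {X : Type*} {ρ : X → X → ℝ} {lam : ℕ → ℝ} {φ : ℕ → X → ℝ} {α : ℝ}

/-- The kernel `∑ₖ H(λₖ / M) φₖ(x) φₖ(y)`. -/
noncomputable def filterKernel (lam : ℕ → ℝ) (φ : ℕ → X → ℝ) (H : ℝ → ℝ) (M : ℝ) (x y : X) : ℝ :=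
  ∑' k, H (lam k / M) * φ k x * φ k y

/-- The polynomial weight `(1 + M min(ρ(x, y), 1))⁻ᵐ`. -/
noncomputable def decayWeight (ρ : X → X → ℝ) (m : ℕ) (M : ℝ) (x y : X) : ℝ :=
  ((1 + M * min (ρ x y) 1) ^ m)⁻¹

theorem decayWeight_pos (hρ : IsQuasiMetric ρ) (m : ℕ) {M : ℝ} (hM : 0 ≤ M) (x y : X) :
    0 < decayWeight ρ m M x y := by
  have := hρ.nonneg x y
  have : 0 ≤ min (ρ x y) 1 := le_min this zero_le_one
  unfold decayWeight
  positivity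

theorem decayWeight_le_one (hρ : IsQuasiMetric ρ) (m : ℕ) {M : ℝ} (hM : 0 ≤ M) (x y : X) :
    decayWeight ρ m M x y ≤ 1 := by
  have := hρ.nonneg x y
  have : 0 ≤ min (ρ x y) 1 := le_min this zero_le_one
  unfold decayWeight
  refine inv_le_one_of_one_le₀ (one_le_pow₀ ?_)
  have := mul_nonneg hM this
  linarith

variable [TopologicalSpace X] [MeasurableSpace X] [BorelSpace X]
  {μ : Measure X} [IsProbabilityMeasure μ]

/-- Convergence is hidden in the lower heat bound: a divergent series has `tsum` equal to `0`, which
contradicts positivity for `t < 1`. Larger times follow by comparison. -/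
theorem IsDiffusionMeasureSpace.summable_heat_diag (hX : IsDiffusionMeasureSpace ρ μ lam φ α)
    (x : X) {t : ℝ} (ht : 0 < t) : Summable fun k => Real.exp (-(lam k) ^ 2 * t) * φ k x ^ 2 := by
  have key : ∀ t : ℝ, 0 < t → t < 1 →
      Summable fun k => Real.exp (-(lam k) ^ 2 * t) * φ k x ^ 2 := by
    intro t ht ht1
    obtain ⟨c, hc, h⟩ := hX.heat_lower
    have h := h x t ht ht1
    by_contra hns
    have : heatKernel lam φ t x x = 0 := by
      refine tsum_eq_zero_of_not_summable fun hs => hns (hs.congr fun k => by ring)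
    rw [this] at h
    have : 0 < c * t ^ (-α / 2) := by positivity
    linarith
  refine (key (min t (1 / 2)) (by positivity)
    ((min_le_right _ _).trans_lt (by norm_num))).of_nonneg_of_le (fun k => by positivity)
    fun k => ?_
  refine mul_le_mul_of_nonneg_right (Real.exp_le_exp.2 ?_) (sq_nonneg _)
  have := min_le_left t (1 / 2)
  nlinarith [sq_nonneg (lam k)]

theorem IsDiffusionMeasureSpace.summable_heat_abs (hX : IsDiffusionMeasureSpace ρ μ lam φ α)
    (x y : X) {t : ℝ} (ht : 0 < t) :
    Summable fun k => Real.exp (-(lam k) ^ 2 * t) * |φ k x * φ k y| := by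
  refine ((hX.summable_heat_diag x ht).add (hX.summable_heat_diag y ht)).of_nonneg_of_le
    (fun k => by positivity) fun k => ?_
  rw [← mul_add, abs_mul]
  gcongr
  nlinarith [sq_nonneg (|φ k x| - |φ k y|), sq_abs (φ k x), sq_abs (φ k y), sq_nonneg (φ k x),
    sq_nonneg (φ k y)]

theorem IsDiffusionMeasureSpace.summable_heat (hX : IsDiffusionMeasureSpace ρ μ lam φ α)
    (x y : X) {t : ℝ} (ht : 0 < t) :
    Summable fun k => Real.exp (-(lam k) ^ 2 * t) * φ k x * φ k y := by
  refine Summable.of_norm ((hX.summable_heat_abs x y ht).congr fun k => ?_)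
  rw [mul_assoc, norm_mul, Real.norm_eq_abs, Real.norm_eq_abs, abs_of_pos (Real.exp_pos _)]

theorem IsDiffusionMeasureSpace.exists_heat_diag_le (hX : IsDiffusionMeasureSpace ρ μ lam φ α) :
    ∃ C : ℝ, 0 < C ∧ ∀ x t, 0 < t → t ≤ 1 →
      ∑' k, Real.exp (-(lam k) ^ 2 * t) * φ k x ^ 2 ≤ C * t ^ (-α / 2) := by
  obtain ⟨C, c, hC, hc, h⟩ := hX.heat_upper
  refine ⟨C, hC, fun x t ht ht1 => ?_⟩
  have h := (le_abs_self _).trans (h x x t ht ht1)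
  rw [(hX.quasiMetric.eq_zero_iff x x).2 rfl] at h
  simp only [ne_eq, OfNat.ofNat_ne_zero, not_false_eq_true, zero_pow, mul_zero, zero_div,
    Real.exp_zero, mul_one] at h
  refine le_trans (le_of_eq ?_) h
  exact tsum_congr fun k => by ring

theorem IsDiffusionMeasureSpace.exists_abs_multiplier_le
    (hX : IsDiffusionMeasureSpace ρ μ lam φ α) :
    ∃ C : ℝ, 0 < C ∧ ∀ x y t, 0 < t → t ≤ 1 →
      ∑' k, Real.exp (-(lam k) ^ 2 * t) * |φ k x * φ k y| ≤ C * t ^ (-α / 2) := by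
  obtain ⟨C, hC, h⟩ := hX.exists_heat_diag_le
  refine ⟨2 * C, by positivity, fun x y t ht ht1 => ?_⟩
  have hs := (hX.summable_heat_diag x ht).add (hX.summable_heat_diag y ht)
  calc _ ≤ ∑' k, (Real.exp (-(lam k) ^ 2 * t) * φ k x ^ 2 +
        Real.exp (-(lam k) ^ 2 * t) * φ k y ^ 2) := by
        refine (hX.summable_heat_abs x y ht).tsum_le_tsum (fun k => ?_) hs
        rw [← mul_add, abs_mul]
        gcongr
        nlinarith [sq_nonneg (|φ k x| - |φ k y|), sq_abs (φ k x), sq_abs (φ k y),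
          sq_nonneg (φ k x), sq_nonneg (φ k y)]
    _ = _ := (hX.summable_heat_diag x ht).tsum_add (hX.summable_heat_diag y ht)
    _ ≤ C * t ^ (-α / 2) + C * t ^ (-α / 2) := add_le_add (h x t ht ht1) (h y t ht ht1)
    _ = _ := by ring

/-- The kernel of the operator `T_n(2u - 1) u`, `u` the heat operator at time `M⁻²`. -/
noncomputable def chebKernel (lam : ℕ → ℝ) (φ : ℕ → X → ℝ) (M : ℝ) (n : ℕ) (x y : X) : ℝ :=
  ∑' k, (shiftedCheb n).eval (Real.exp (-(lam k) ^ 2 * (M ^ 2)⁻¹)) *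
    (Real.exp (-(lam k) ^ 2 * (M ^ 2)⁻¹) * φ k x * φ k y)

theorem exp_mem_Icc (l : ℝ) {t : ℝ} (ht : 0 ≤ t) : Real.exp (-l ^ 2 * t) ∈ Icc (0 : ℝ) 1 := by
  refine ⟨(Real.exp_pos _).le, Real.exp_le_one_iff.2 ?_⟩
  have := sq_nonneg l
  nlinarith

theorem inv_sq_rpow {M : ℝ} (hM : 0 < M) (α : ℝ) : ((M ^ 2)⁻¹) ^ (-α / 2) = M ^ α := by
  rw [Real.inv_rpow (by positivity), ← Real.rpow_natCast M 2, ← Real.rpow_mul hM.le,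
    ← Real.rpow_neg hM.le]
  congr 1
  push_cast; ring

theorem IsDiffusionMeasureSpace.exists_abs_chebKernel_le
    (hX : IsDiffusionMeasureSpace ρ μ lam φ α) (m : ℕ) :
    ∃ C : ℝ, 0 < C ∧ ∀ M : ℝ, 1 ≤ M → ∀ (n : ℕ) x y,
      |chebKernel lam φ M n x y| ≤ C * M ^ α * (1 + (n : ℝ)) ^ m * decayWeight ρ m M x y := by
  obtain ⟨C₁, hC₁, h₁⟩ := hX.exists_abs_multiplier_le
  obtain ⟨C₂, c, hC₂, hc, h₂⟩ := hX.heat_upper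
  -- `δ ≤ c / 3` makes the Gaussian factor at most `exp(-3v)` when `n + 1 ≤ δ v`. `δ ≤ 1` keeps the
  -- times `(j + 1) / M²` at most `1` and the coefficient sum `exp(2n)` below `exp(2v)`, so
  -- `exp(-v)` remains.
  set δ := min 1 (c / 3) with hδ
  have hδ0 : 0 < δ := by positivity
  set C₃ := C₂ * (m.factorial * Real.exp 1) with hC₃
  set C₄ := C₁ * ((1 + δ) / δ) ^ m with hC₄
  refine ⟨C₃ + C₄, by positivity, fun M hM n x y => ?_⟩
  have hM0 : 0 < M := by linarith
  have hMi : 0 < (M ^ 2)⁻¹ := by positivity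
  have hMi1 : (M ^ 2)⁻¹ ≤ 1 := inv_le_one_of_one_le₀ (one_le_pow₀ hM)
  set d := min (ρ x y) 1 with hd
  have hd0 : 0 ≤ d := le_min (hX.quasiMetric.nonneg x y) zero_le_one
  have hd1 : d ≤ 1 := min_le_right _ _
  set v := M * d with hv
  have hv0 : 0 ≤ v := by positivity
  have hW : decayWeight ρ m M x y = ((1 + v) ^ m)⁻¹ := rfl
  have hMα : 0 < M ^ α := by positivity
  rw [hW]
  have hu : ∀ k, Real.exp (-(lam k) ^ 2 * (M ^ 2)⁻¹) ∈ Icc (0 : ℝ) 1 := fun k =>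
    exp_mem_Icc _ hMi.le
  rcases le_or_gt ((n : ℝ) + 1) (δ * v) with hn | hn
  · have hexp : chebKernel lam φ M n x y = ∑ j ∈ Finset.range (n + 1),
        (shiftedCheb n).coeff j * heatKernel lam φ (((j : ℝ) + 1) * (M ^ 2)⁻¹) x y := by
      have hsum : ∀ j ∈ Finset.range (n + 1), Summable fun k => (shiftedCheb n).coeff j *
          (Real.exp (-(lam k) ^ 2 * (((j : ℝ) + 1) * (M ^ 2)⁻¹)) * φ k x * φ k y) :=
        fun j _ => (hX.summable_heat x y (by positivity)).mul_left _
      simp only [heatKernel, ← tsum_mul_left]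
      rw [← Summable.tsum_finsetSum hsum]
      refine tsum_congr fun k => ?_
      rw [Polynomial.eval_eq_sum_range' (Nat.lt_succ_of_le (shiftedCheb_natDegree_le n)),
        Finset.sum_mul]
      refine Finset.sum_congr rfl fun j _ => ?_
      have : Real.exp (-(lam k) ^ 2 * (((j : ℝ) + 1) * (M ^ 2)⁻¹)) =
          Real.exp (-(lam k) ^ 2 * (M ^ 2)⁻¹) ^ j * Real.exp (-(lam k) ^ 2 * (M ^ 2)⁻¹) := by
        rw [← Real.exp_nat_mul, ← Real.exp_add]
        congr 1; ring
      rw [this]; ring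
    have hvM : v ≤ M := by rw [hv]; nlinarith
    have hnM : (n : ℝ) + 1 ≤ M ^ 2 := by
      have : δ ≤ 1 := min_le_left _ _
      nlinarith
    have hG : ∀ j ∈ Finset.range (n + 1), |heatKernel lam φ (((j : ℝ) + 1) * (M ^ 2)⁻¹) x y| ≤
        C₂ * M ^ α * Real.exp (-3 * v) := by
      intro j hj
      have hj' : (j : ℝ) ≤ n := by exact_mod_cast Nat.lt_succ_iff.1 (Finset.mem_range.1 hj)
      have hj0 : (0 : ℝ) ≤ j := Nat.cast_nonneg j
      have ht0 : 0 < ((j : ℝ) + 1) * (M ^ 2)⁻¹ := by positivity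
      refine (h₂ x y _ ht0 ?_).trans ?_
      · rw [← div_eq_mul_inv, div_le_one (by positivity)]; linarith
      gcongr
      · rw [← inv_sq_rpow hM0]
        refine Real.rpow_le_rpow_of_nonpos hMi ?_ (by linarith [hX.alpha_pos])
        nlinarith
      · rw [neg_mul, neg_div, neg_mul, neg_le_neg_iff, le_div_iff₀ ht0]
        have hδc : 3 * δ ≤ c := by
          have : δ ≤ c / 3 := min_le_right _ _
          linarith
        have hρd : d ^ 2 ≤ ρ x y ^ 2 := by
          have : d ≤ ρ x y := min_le_left _ _
          gcongr
        have h1 : ((j : ℝ) + 1) * v ≤ δ * v ^ 2 := by nlinarith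
        calc 3 * v * (((j : ℝ) + 1) * (M ^ 2)⁻¹) = 3 * (((j : ℝ) + 1) * v) * (M ^ 2)⁻¹ := by ring
          _ ≤ 3 * (δ * v ^ 2) * (M ^ 2)⁻¹ := by gcongr
          _ = 3 * δ * d ^ 2 := by rw [hv]; field_simp
          _ ≤ c * ρ x y ^ 2 := by gcongr
    calc |chebKernel lam φ M n x y|
        ≤ ∑ j ∈ Finset.range (n + 1), |(shiftedCheb n).coeff j| *
            (C₂ * M ^ α * Real.exp (-3 * v)) := by
          rw [hexp]
          refine (Finset.abs_sum_le_sum_abs _ _).trans (Finset.sum_le_sum fun j hj => ?_)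
          rw [abs_mul]
          exact mul_le_mul_of_nonneg_left (hG j hj) (abs_nonneg _)
      _ ≤ Real.exp (2 * n) * (C₂ * M ^ α * Real.exp (-3 * v)) := by
          rw [← Finset.sum_mul]
          gcongr
          exact (sum_abs_coeff_shiftedCheb_le n _).trans (seven_pow_le_exp n)
      _ = C₂ * M ^ α * Real.exp (2 * n - 3 * v) := by
          rw [sub_eq_add_neg, Real.exp_add, neg_mul]; ring
      _ ≤ C₂ * M ^ α * Real.exp (-v) := by
          gcongr
          have : δ ≤ 1 := min_le_left _ _
          nlinarith
      _ ≤ C₂ * M ^ α * ((m.factorial * Real.exp 1) * ((1 + v) ^ m)⁻¹) := by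
          gcongr
          exact exp_neg_le_div_one_add_pow m hv0
      _ = C₃ * M ^ α * 1 * ((1 + v) ^ m)⁻¹ := by rw [hC₃]; ring
      _ ≤ (C₃ + C₄) * M ^ α * (1 + (n : ℝ)) ^ m * ((1 + v) ^ m)⁻¹ := by
          have : (1 : ℝ) ≤ (1 + (n : ℝ)) ^ m := one_le_pow₀ (by simp)
          have : 0 < C₄ := by positivity
          gcongr
          linarith
  -- High degree: `1 + v` is at most a multiple of `1 + n`, so no decay is needed; the diagonal
  -- bound with `|T_n| ≤ 1` is enough.
  · have hsa := hX.summable_heat_abs x y hMi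
    have hle : ∀ k, ‖(shiftedCheb n).eval (Real.exp (-(lam k) ^ 2 * (M ^ 2)⁻¹)) *
        (Real.exp (-(lam k) ^ 2 * (M ^ 2)⁻¹) * φ k x * φ k y)‖ ≤
        Real.exp (-(lam k) ^ 2 * (M ^ 2)⁻¹) * |φ k x * φ k y| := by
      intro k
      rw [norm_mul, mul_assoc (Real.exp _), norm_mul, Real.norm_eq_abs, Real.norm_eq_abs,
        Real.norm_eq_abs, abs_of_pos (Real.exp_pos _)]
      refine mul_le_of_le_one_left (by positivity) (abs_shiftedCheb_eval_le_one n (hu k))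
    have h1v : ((1 + v) ^ m : ℝ) ≤ ((1 + δ) / δ) ^ m * (1 + (n : ℝ)) ^ m := by
      rw [← mul_pow]
      gcongr
      rw [div_mul_eq_mul_div, le_div_iff₀ hδ0]
      have : (0 : ℝ) ≤ n := Nat.cast_nonneg n
      nlinarith
    calc |chebKernel lam φ M n x y| ≤ _ := tsum_of_norm_bounded hsa.hasSum hle
      _ ≤ C₁ * M ^ α := by
          have := h₁ x y _ hMi hMi1
          rwa [inv_sq_rpow hM0] at this
      _ = C₁ * M ^ α * ((1 + v) ^ m * ((1 + v) ^ m)⁻¹) := by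
          rw [mul_inv_cancel₀ (by positivity), mul_one]
      _ ≤ C₁ * M ^ α * (((1 + δ) / δ) ^ m * (1 + (n : ℝ)) ^ m * ((1 + v) ^ m)⁻¹) := by gcongr
      _ = C₄ * M ^ α * (1 + (n : ℝ)) ^ m * ((1 + v) ^ m)⁻¹ := by rw [hC₄]; ring
      _ ≤ _ := by
          have : 0 < C₃ := by positivity
          gcongr
          linarith

/-- Localization of the filtered kernels. -/
theorem IsDiffusionMeasureSpace.exists_abs_filterKernel_le
    (hX : IsDiffusionMeasureSpace ρ μ lam φ α) {H : ℝ → ℝ} (hH : IsLowPass H) (m : ℕ) :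
    ∃ C : ℝ, 0 < C ∧ ∀ M : ℝ, 1 ≤ M → ∀ x y,
      |filterKernel lam φ H M x y| ≤ C * M ^ α * decayWeight ρ m M x y := by
  obtain ⟨c, hc, hcu⟩ := exists_shiftedCheb_expansion
    (G := heatProfile H) fun u hu => hH.contDiffAt_heatProfile hu
  obtain ⟨C, hC, hA⟩ := hX.exists_abs_chebKernel_le m
  -- The price `(1 + n)^m` of the degree `n` is summable against the Chebyshev coefficients.
  set D := ∑' n : ℤ, |c n| * (1 + |(n : ℝ)|) ^ m with hD
  have hD0 : 0 ≤ D := tsum_nonneg fun n => by positivity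
  refine ⟨C * (D + 1), by positivity, fun M hM x y => ?_⟩
  have hM0 : 0 < M := by linarith
  have hMi : 0 < (M ^ 2)⁻¹ := by positivity
  have hW := decayWeight_pos hX.quasiMetric m hM0.le x y
  set u : ℕ → ℝ := fun k => Real.exp (-(lam k) ^ 2 * (M ^ 2)⁻¹) with hu
  have huI : ∀ k, u k ∈ Icc (0 : ℝ) 1 := fun k => exp_mem_Icc _ hMi.le
  set F : ℤ → ℕ → ℝ := fun n k =>
    c n * ((shiftedCheb n.natAbs).eval (u k) * (u k * φ k x * φ k y)) with hF
  -- Absolute convergence of the double series allows the sums over degrees and over frequencies to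
  -- be exchanged.
  have hsum : Summable (Function.uncurry F) := by
    have h1 : Summable fun n : ℤ => |c n| := by simpa using hc 0
    have h2 := h1.mul_of_nonneg (hX.summable_heat_abs x y hMi) (fun n => abs_nonneg _)
      (fun k => by positivity)
    refine h2.of_norm_bounded fun p => ?_
    simp only [Function.uncurry, hF, norm_mul, Real.norm_eq_abs, abs_mul]
    rw [abs_of_nonneg (huI p.2).1]
    refine mul_le_mul_of_nonneg_left ?_ (abs_nonneg _)
    rw [mul_assoc (u p.2)]
    exact mul_le_of_le_one_left (mul_nonneg (huI p.2).1 (by positivity))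
      (abs_shiftedCheb_eval_le_one _ (huI p.2))
  have hK : filterKernel lam φ H M x y = ∑' n : ℤ, c n * chebKernel lam φ M n.natAbs x y := by
    have e1 : filterKernel lam φ H M x y = ∑' k, ∑' n : ℤ, F n k := by
      refine tsum_congr fun k => ?_
      have h := (hcu (u k) (huI k)).mul_right (u k * φ k x * φ k y)
      have h' : heatProfile H (u k) * (u k * φ k x * φ k y) = H (lam k / M) * φ k x * φ k y := by
        rw [← heatProfile_mul_exp H (hX.lam_nonneg k) hM0]; ring
      rw [h'] at h
      rw [← h.tsum_eq]
      exact tsum_congr fun n => by simp only [hF]; ring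
    rw [e1, hsum.tsum_comm]
    exact tsum_congr fun n => tsum_mul_left
  have hbd : ∀ n : ℤ, ‖c n * chebKernel lam φ M n.natAbs x y‖ ≤
      (C * M ^ α * decayWeight ρ m M x y) * (|c n| * (1 + |(n : ℝ)|) ^ m) := by
    intro n
    rw [norm_mul, Real.norm_eq_abs, Real.norm_eq_abs]
    have := hA M hM n.natAbs x y
    rw [show ((n.natAbs : ℕ) : ℝ) = |(n : ℝ)| by simp [Nat.cast_natAbs]] at this
    calc _ ≤ |c n| * (C * M ^ α * (1 + |(n : ℝ)|) ^ m * decayWeight ρ m M x y) := by gcongr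
      _ = _ := by ring
  rw [hK]
  have := tsum_of_norm_bounded ((hc m).hasSum.mul_left (C * M ^ α * decayWeight ρ m M x y)) hbd
  rw [← hD, Real.norm_eq_abs] at this
  refine this.trans ?_
  have : 0 < M ^ α := by positivity
  calc C * M ^ α * decayWeight ρ m M x y * D ≤ C * M ^ α * decayWeight ρ m M x y * (D + 1) := by
        gcongr; linarith
    _ = _ := by ring

end Kernel

end DiffusionSpace

/-! ### Weight integrals and lower bounds for the kernels -/

namespace DiffusionSpace

variable {X : Type*} {ρ : X → X → ℝ} {lam : ℕ → ℝ} {φ : ℕ → X → ℝ} {α : ℝ}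

theorem filterKernel_symm (H : ℝ → ℝ) (M : ℝ) (x y : X) :
    filterKernel lam φ H M x y = filterKernel lam φ H M y x :=
  tsum_congr fun k => by ring

theorem phi_mem_diffPoly {k : ℕ} {M : ℝ} (hk : lam k ≤ M) : φ k ∈ diffPoly lam φ M :=
  Submodule.subset_span ⟨k, hk, rfl⟩

theorem diffPoly_mono {M M' : ℝ} (h : M ≤ M') : diffPoly lam φ M ≤ diffPoly lam φ M' :=
  Submodule.span_mono (image_mono fun _ hk => le_trans hk h)

theorem decayWeight_symm (hρ : IsQuasiMetric ρ) (m : ℕ) (M : ℝ) (x y : X) :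
    decayWeight ρ m M x y = decayWeight ρ m M y x := by
  rw [decayWeight, decayWeight, hρ.symm]

theorem decayWeight_pow (m B : ℕ) (M : ℝ) (x y : X) :
    decayWeight ρ (m * B) M x y = decayWeight ρ m M x y ^ B := by
  rw [decayWeight, decayWeight, pow_mul, inv_pow]

/-- The weights vary slowly. -/
theorem IsQuasiMetric.exists_decayWeight_mul_le (hρ : IsQuasiMetric ρ) (m : ℕ) :
    ∃ κ : ℝ, 0 < κ ∧ ∀ M : ℝ, 0 ≤ M → ∀ x y z,
      decayWeight ρ m M x y * decayWeight ρ m M y z ≤ κ * decayWeight ρ m M x z := by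
  obtain ⟨κ, hκ, htri⟩ := hρ.quasi_triangle
  refine ⟨κ ^ m, by positivity, fun M hM x y z => ?_⟩
  have h0 := fun a b => le_min (hρ.nonneg a b) zero_le_one
  have hxy := mul_nonneg hM (h0 x y)
  have hyz := mul_nonneg hM (h0 y z)
  have hxz := mul_nonneg hM (h0 x z)
  -- Truncation at `1` preserves the quasi-triangle inequality because `κ ≥ 1`.
  have hd : min (ρ x z) 1 ≤ κ * (min (ρ x y) 1 + min (ρ y z) 1) := by
    have h1 := htri x y z
    have := h0 x y
    have := h0 y z
    have := hρ.nonneg x y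
    have := hρ.nonneg y z
    rcases le_total (ρ x y) 1 with h2 | h2
    · rcases le_total (ρ y z) 1 with h3 | h3
      · rw [min_eq_left h2, min_eq_left h3]
        exact (min_le_left _ _).trans h1
      · rw [min_eq_right h3]
        refine (min_le_right _ _).trans ?_
        nlinarith
    · rw [min_eq_right h2]
      refine (min_le_right _ _).trans ?_
      nlinarith
  rw [decayWeight, decayWeight, decayWeight, ← mul_inv, ← mul_pow, ← div_eq_mul_inv,
    le_div_iff₀ (by positivity), inv_mul_le_iff₀ (by positivity), ← mul_pow]
  gcongr
  nlinarith [mul_le_mul_of_nonneg_left hd hM, mul_nonneg hxy hyz]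

/-- Either `a² ≤ η w`, or `(η w)^(q/2)` is below `a^q`, and then a factor `w^(q/2)` of `w^(2B) ≤ w ·
w^(q/2)` can be traded for `a^q`. This converts an `L₂` lower bound into a weighted `L_q` lower
bound for any `q`. -/
theorem sq_le_add_of_le_pow {a C w η q : ℝ} {B : ℕ} (ha : 0 ≤ a) (hw : 0 < w) (hw1 : w ≤ 1)
    (hη : 0 < η) (hq : 0 < q) (hB : 1 + q / 2 ≤ 2 * B) (haC : a ≤ C * w ^ B) :
    a ^ 2 ≤ η * w + C ^ 2 * η ^ (-(q / 2)) * (w * a ^ q) := by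
  rcases le_or_gt (a ^ 2) (η * w) with h | h
  · have : 0 ≤ C ^ 2 * η ^ (-(q / 2)) * (w * a ^ q) := by positivity
    linarith
  · have h1 : (η * w) ^ (q / 2) ≤ a ^ q := by
      calc (η * w) ^ (q / 2) ≤ (a ^ 2) ^ (q / 2) :=
            Real.rpow_le_rpow (by positivity) h.le (by positivity)
        _ = a ^ q := by
            rw [← Real.rpow_natCast a 2, ← Real.rpow_mul ha]; congr 1; push_cast; ring
    have h2 : w ^ (q / 2) ≤ η ^ (-(q / 2)) * a ^ q := by
      rw [Real.mul_rpow hη.le hw.le] at h1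
      rw [Real.rpow_neg hη.le, ← div_eq_inv_mul, le_div_iff₀ (by positivity)]
      linarith
    have h3 : (w ^ B) ^ 2 ≤ w * w ^ (q / 2) := by
      rw [← pow_mul, ← Real.rpow_natCast, ← Real.rpow_one_add' hw.le (by positivity)]
      refine Real.rpow_le_rpow_of_exponent_ge hw hw1 ?_
      push_cast; linarith
    calc a ^ 2 ≤ (C * w ^ B) ^ 2 := by gcongr
      _ = C ^ 2 * (w ^ B) ^ 2 := by ring
      _ ≤ C ^ 2 * (w * (η ^ (-(q / 2)) * a ^ q)) := by
          gcongr
          exact h3.trans (by gcongr)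
      _ = C ^ 2 * η ^ (-(q / 2)) * (w * a ^ q) := by ring
      _ ≤ _ := by
          have : 0 < η * w := by positivity
          linarith

variable [TopologicalSpace X] [MeasurableSpace X] [BorelSpace X]
  {μ : Measure X} [IsProbabilityMeasure μ]

theorem IsDiffusionMeasureSpace.measurable_decayWeight
    (hX : IsDiffusionMeasureSpace ρ μ lam φ α) (m : ℕ) (M : ℝ) (x : X) :
    Measurable (decayWeight ρ m M x) := by
  have := hX.measurable_dist x
  unfold decayWeight
  fun_prop

/-- Dyadic decomposition: where `1 + M d` is about `2^j` the weight is at most `2^(-jm)`, and that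
region has measure `O((2^j / M)^α)`. With `m ≥ α + 1` the sum is dominated by a geometric series of
ratio `1/2`. -/
theorem IsDiffusionMeasureSpace.exists_lintegral_decayWeight_le
    (hX : IsDiffusionMeasureSpace ρ μ lam φ α) {m : ℕ} (hm : α + 1 ≤ m) :
    ∃ C : ℝ, 0 < C ∧ ∀ M : ℝ, 1 ≤ M → ∀ x,
      ∫⁻ y, ENNReal.ofReal (decayWeight ρ m M x y) ∂μ ≤ ENNReal.ofReal (C * M ^ (-α)) := by
  obtain ⟨C₀, hC₀, hvol⟩ := hX.volume_le
  have hα := hX.alpha_pos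
  refine ⟨(C₀ + 1) * 2 ^ α * 2, by positivity, fun M hM x => ?_⟩
  have hM0 : 0 < M := by linarith
  set d : X → ℝ := fun y => min (ρ x y) 1 with hd
  have hd0 : ∀ y, 0 ≤ d y := fun y => le_min (hX.quasiMetric.nonneg x y) zero_le_one
  set E : ℕ → Set X := fun j => {y | M * d y ≤ 2 ^ (j + 1)} with hE
  have hdm : Measurable d := (hX.measurable_dist x).min measurable_const
  have hEm : ∀ j, MeasurableSet (E j) := fun j =>
    measurableSet_le (measurable_const.mul hdm) measurable_const
  have hEμ : ∀ j : ℕ, μ (E j) ≤ ENNReal.ofReal ((C₀ + 1) * (2 ^ (j + 1) / M) ^ α) := by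
    intro j
    set t : ℝ := 2 ^ (j + 1) / M with ht
    have ht0 : 0 < t := by positivity
    -- For `t ≥ 1` the truncated distance no longer confines `E j` to a ball, and the total mass `1`
    -- is used; this is why the constant is `C₀ + 1`.
    rcases lt_or_ge t 1 with h1 | h1
    · have hsub : E j ⊆ cball ρ x t := by
        intro y hy
        have hy' : d y ≤ t := by
          rw [ht, le_div_iff₀ hM0, mul_comm]; exact hy
        rcases min_le_iff.1 hy' with h | h
        · exact h
        · linarith
      calc μ (E j) ≤ μ (cball ρ x t) := measure_mono hsub
        _ = ENNReal.ofReal (μ.real (cball ρ x t)) := (ofReal_measureReal).symm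
        _ ≤ _ := by
          refine ENNReal.ofReal_le_ofReal ((hvol x t ht0).trans ?_)
          gcongr
          linarith
    · calc μ (E j) ≤ 1 := prob_le_one
        _ = ENNReal.ofReal 1 := by simp
        _ ≤ _ := by
          refine ENNReal.ofReal_le_ofReal ?_
          have : 1 ≤ t ^ α := Real.one_le_rpow h1 hα.le
          nlinarith
  have hpt : ∀ y, ENNReal.ofReal (decayWeight ρ m M x y) ≤
      ∑' j : ℕ, (E j).indicator (fun _ => ENNReal.ofReal ((2 ^ (j * m) : ℝ)⁻¹)) y := by
    intro y
    have hv : 0 ≤ M * d y := mul_nonneg hM0.le (hd0 y)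
    obtain ⟨j, hj1, hj2⟩ := exists_nat_pow_near (x := 1 + M * d y) (y := 2) (by linarith)
      (by norm_num)
    refine le_trans ?_ (ENNReal.le_tsum j)
    rw [indicator_of_mem (show y ∈ E j by simp only [hE]; exact (by linarith : M * d y ≤ _))]
    refine ENNReal.ofReal_le_ofReal ?_
    rw [decayWeight, pow_mul]
    gcongr
  have hterm : ∀ j : ℕ, ENNReal.ofReal ((2 ^ (j * m) : ℝ)⁻¹) * μ (E j) ≤
      ENNReal.ofReal ((C₀ + 1) * 2 ^ α * M ^ (-α)) * 2⁻¹ ^ j := by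
    intro j
    have h2 : (2⁻¹ : ℝ≥0∞) ^ j = ENNReal.ofReal ((2⁻¹ : ℝ) ^ j) := by
      rw [ENNReal.ofReal_pow (by norm_num), ENNReal.ofReal_inv_of_pos (by norm_num)]; simp
    rw [h2, ← ENNReal.ofReal_mul (by positivity)]
    refine (mul_le_mul_right (hEμ j) _).trans ?_
    rw [← ENNReal.ofReal_mul (by positivity)]
    refine ENNReal.ofReal_le_ofReal ?_
    have e1 : ((2 : ℝ) ^ (j + 1) / M) ^ α = (2 ^ α * M ^ (-α)) * ((2 : ℝ) ^ j) ^ α := by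
      rw [Real.div_rpow (by positivity) hM0.le, pow_succ, Real.mul_rpow (by positivity)
        (by positivity), Real.rpow_neg hM0.le]
      field_simp
    have e2 : ((2 : ℝ) ^ j) ^ α * 2 ^ j ≤ 2 ^ (j * m) := by
      rw [← Real.rpow_natCast 2 j, ← Real.rpow_mul (by norm_num), ← Real.rpow_add (by norm_num),
        ← Real.rpow_natCast 2 (j * m)]
      refine Real.rpow_le_rpow_of_exponent_le (by norm_num) ?_
      push_cast
      have : (0 : ℝ) ≤ j := Nat.cast_nonneg j
      nlinarith
    rw [e1]
    calc ((2 : ℝ) ^ (j * m))⁻¹ * ((C₀ + 1) * ((2 ^ α * M ^ (-α)) * ((2 : ℝ) ^ j) ^ α))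
        = ((C₀ + 1) * 2 ^ α * M ^ (-α)) * (((2 : ℝ) ^ j) ^ α / 2 ^ (j * m)) := by
          field_simp
      _ ≤ ((C₀ + 1) * 2 ^ α * M ^ (-α)) * 2⁻¹ ^ j := by
          gcongr
          rw [div_le_iff₀ (by positivity), inv_pow, ← div_eq_inv_mul, le_div_iff₀ (by positivity)]
          exact e2
  calc ∫⁻ y, ENNReal.ofReal (decayWeight ρ m M x y) ∂μ
      ≤ ∫⁻ y, ∑' j : ℕ, (E j).indicator (fun _ => ENNReal.ofReal ((2 ^ (j * m) : ℝ)⁻¹)) y ∂μ :=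
        lintegral_mono hpt
    _ = ∑' j : ℕ, ENNReal.ofReal ((2 ^ (j * m) : ℝ)⁻¹) * μ (E j) := by
        rw [lintegral_tsum fun j => (measurable_const.indicator (hEm j)).aemeasurable]
        exact tsum_congr fun j => lintegral_indicator_const (hEm j) _
    _ ≤ ∑' j : ℕ, ENNReal.ofReal ((C₀ + 1) * 2 ^ α * M ^ (-α)) * 2⁻¹ ^ j :=
        ENNReal.tsum_le_tsum hterm
    _ = ENNReal.ofReal ((C₀ + 1) * 2 ^ α * M ^ (-α)) * 2 := by
        rw [ENNReal.tsum_mul_left, ENNReal.tsum_geometric, ENNReal.one_sub_inv_two, inv_inv]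
    _ = ENNReal.ofReal ((C₀ + 1) * 2 ^ α * 2 * M ^ (-α)) := by
        rw [show (2 : ℝ≥0∞) = ENNReal.ofReal 2 by simp, ← ENNReal.ofReal_mul (by positivity)]
        congr 1; ring

/-- The indices of the frequencies at most `M`. -/
noncomputable def IsDiffusionMeasureSpace.freq (hX : IsDiffusionMeasureSpace ρ μ lam φ α)
    (M : ℝ) : Finset ℕ := (hX.finite_lam_le M).toFinset

theorem IsDiffusionMeasureSpace.mem_freq (hX : IsDiffusionMeasureSpace ρ μ lam φ α) {M : ℝ}
    {k : ℕ} : k ∈ hX.freq M ↔ lam k ≤ M := by simp [freq]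

theorem IsDiffusionMeasureSpace.filter_eq_zero (hX : IsDiffusionMeasureSpace ρ μ lam φ α)
    {H : ℝ → ℝ} (hH : IsLowPass H) {M : ℝ} (hM : 0 < M) {k : ℕ} (hk : k ∉ hX.freq M) :
    H (lam k / M) = 0 := by
  rw [hX.mem_freq, not_le] at hk
  exact hH.eq_zero _ ((one_le_div hM).2 hk.le)

theorem IsDiffusionMeasureSpace.filterKernel_eq_sum (hX : IsDiffusionMeasureSpace ρ μ lam φ α)
    {H : ℝ → ℝ} (hH : IsLowPass H) {M : ℝ} (hM : 0 < M) (x y : X) :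
    filterKernel lam φ H M x y = ∑ k ∈ hX.freq M, H (lam k / M) * φ k x * φ k y :=
  tsum_eq_sum fun k hk => by rw [hX.filter_eq_zero hH hM hk]; ring

theorem IsDiffusionMeasureSpace.filterKernel_mem (hX : IsDiffusionMeasureSpace ρ μ lam φ α)
    {H : ℝ → ℝ} (hH : IsLowPass H) {M : ℝ} (hM : 0 < M) (x : X) :
    filterKernel lam φ H M x ∈ diffPoly lam φ M := by
  have : filterKernel lam φ H M x = ∑ k ∈ hX.freq M, (H (lam k / M) * φ k x) • φ k := by
    ext y
    rw [hX.filterKernel_eq_sum hH hM]; simp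
  rw [this]
  exact Submodule.sum_mem _ fun k hk => Submodule.smul_mem _ _ (phi_mem_diffPoly (hX.mem_freq.1 hk))

theorem IsDiffusionMeasureSpace.continuous_of_mem (hX : IsDiffusionMeasureSpace ρ μ lam φ α)
    {M : ℝ} {P : X → ℝ} (hP : P ∈ diffPoly lam φ M) : Continuous P := by
  refine Submodule.span_induction (p := fun P _ => Continuous P) ?_ continuous_const
    (fun _ _ _ _ h1 h2 => h1.add h2) (fun c _ _ h => h.const_smul c) hP
  rintro _ ⟨k, -, rfl⟩
  exact hX.continuous_phi k

/-- A single term of the diagonal heat series at time `1` is at most the whole sum. -/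
theorem IsDiffusionMeasureSpace.exists_abs_phi_le (hX : IsDiffusionMeasureSpace ρ μ lam φ α)
    (k : ℕ) : ∃ B : ℝ, ∀ x, |φ k x| ≤ B := by
  obtain ⟨C, hC, h⟩ := hX.exists_heat_diag_le
  refine ⟨Real.sqrt (C / Real.exp (-(lam k) ^ 2)), fun x => Real.abs_le_sqrt ?_⟩
  have h1 := h x 1 one_pos le_rfl
  have h2 := (hX.summable_heat_diag x one_pos).le_tsum k fun j _ => by positivity
  rw [Real.one_rpow, mul_one] at h1
  rw [mul_one] at h2
  rw [le_div_iff₀ (Real.exp_pos _)]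
  linarith

theorem IsDiffusionMeasureSpace.exists_abs_le_of_mem (hX : IsDiffusionMeasureSpace ρ μ lam φ α)
    {M : ℝ} {P : X → ℝ} (hP : P ∈ diffPoly lam φ M) : ∃ B : ℝ, ∀ x, |P x| ≤ B := by
  refine Submodule.span_induction (p := fun P _ => ∃ B : ℝ, ∀ x, |P x| ≤ B) ?_ ⟨0, by simp⟩
    ?_ ?_ hP
  · rintro _ ⟨k, -, rfl⟩
    exact hX.exists_abs_phi_le k
  · rintro P Q _ _ ⟨B, hB⟩ ⟨B', hB'⟩
    exact ⟨B + B', fun x => (abs_add_le _ _).trans (add_le_add (hB x) (hB' x))⟩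
  · rintro c P _ ⟨B, hB⟩
    refine ⟨|c| * B, fun x => ?_⟩
    rw [Pi.smul_apply, smul_eq_mul, abs_mul]
    exact mul_le_mul_of_nonneg_left (hB x) (abs_nonneg _)

theorem IsDiffusionMeasureSpace.integral_phi_mul_phi (hX : IsDiffusionMeasureSpace ρ μ lam φ α)
    (j k : ℕ) : ∫ x, φ j x * φ k x ∂μ = if j = k then 1 else 0 := by
  obtain ⟨b, hb⟩ := hX.basis
  have h := orthonormal_iff_ite.1 b.orthonormal j k
  rw [← h, L2.inner_def]
  refine integral_congr_ae ?_
  filter_upwards [hb j, hb k] with x hj hk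
  rw [hj, hk]; simp [mul_comm]

theorem IsDiffusionMeasureSpace.integrable_of_mem (hX : IsDiffusionMeasureSpace ρ μ lam φ α)
    {M : ℝ} {P : X → ℝ} (hP : P ∈ diffPoly lam φ M) {ν : Measure X} [IsFiniteMeasure ν]
    {g : X → ℝ} (hg : Integrable g ν) : Integrable (fun x => g x * P x) ν := by
  obtain ⟨B, hB⟩ := hX.exists_abs_le_of_mem hP
  exact hg.mul_bdd (hX.continuous_of_mem hP).measurable.aestronglyMeasurable
    (Eventually.of_forall hB)

theorem IsDiffusionMeasureSpace.integrable_phi_mul_phi (hX : IsDiffusionMeasureSpace ρ μ lam φ α)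
    {ν : Measure X} [IsFiniteMeasure ν] (j k : ℕ) : Integrable (fun x => φ j x * φ k x) ν := by
  refine hX.integrable_of_mem (phi_mem_diffPoly (le_refl (lam k))) ?_
  have := hX.integrable_of_mem (phi_mem_diffPoly (φ := φ) (le_refl (lam j))) (ν := ν)
    (integrable_const 1)
  simpa using this

/-- At time `t = A / M²` the frequencies above `M / 2` contribute to the diagonal at most `exp(-A /
8)` times its value at time `t / 2`. For large `A` this is at most half of the lower heat bound, so
the low frequencies carry the rest. If `M² ≤ A`, then `φ₀ = 1` alone suffices. -/
theorem IsDiffusionMeasureSpace.exists_le_sum_sq (hX : IsDiffusionMeasureSpace ρ μ lam φ α) :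
    ∃ c : ℝ, 0 < c ∧ ∀ M : ℝ, 1 ≤ M → ∀ x, c * M ^ α ≤ ∑ k ∈ hX.freq (M / 2), φ k x ^ 2 := by
  obtain ⟨c, hc, hlow⟩ := hX.heat_lower
  obtain ⟨C, hC, hup⟩ := hX.exists_heat_diag_le
  have hα := hX.alpha_pos
  obtain ⟨A, hA1, hA⟩ : ∃ A : ℝ, 1 ≤ A ∧
      C * 2 ^ (α / 2) * Real.exp (-(A / 8)) ≤ c / 2 := by
    have hlim : Tendsto (fun A : ℝ => C * 2 ^ (α / 2) * Real.exp (-(A / 8))) atTop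
        (𝓝 (C * 2 ^ (α / 2) * 0)) := by
      refine Tendsto.const_mul _ (Real.tendsto_exp_neg_atTop_nhds_zero.comp ?_)
      exact tendsto_id.atTop_div_const (by norm_num)
    rw [mul_zero] at hlim
    have h2 := hlim.eventually (gt_mem_nhds (by positivity : 0 < c / 2))
    obtain ⟨A, hA, hA'⟩ := ((eventually_ge_atTop 1).and h2).exists
    exact ⟨A, hA, hA'.le⟩
  have hA0 : 0 < A := by linarith
  refine ⟨min (c / 2) 1 * A ^ (-(α / 2)), by positivity, fun M hM x => ?_⟩
  have hM0 : 0 < M := by linarith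
  have hMα : A ^ (-(α / 2)) * M ^ α = (A * (M ^ 2)⁻¹) ^ (-α / 2) := by
    rw [Real.mul_rpow hA0.le (by positivity), inv_sq_rpow hM0, neg_div]
  rw [mul_assoc, hMα]
  rcases lt_or_ge A (M ^ 2) with h | h
  · set t := A * (M ^ 2)⁻¹ with ht
    have ht0 : 0 < t := by positivity
    have ht1 : t < 1 := by rw [ht, ← div_eq_mul_inv, div_lt_one (by positivity)]; exact h
    have hs := hX.summable_heat_diag x ht0
    have hs2 := hX.summable_heat_diag x (half_pos ht0)
    have h1 := hlow x t ht0 ht1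
    have h2 := hup x (t / 2) (by positivity) (by linarith)
    have e1 : heatKernel lam φ t x x = ∑' k, Real.exp (-(lam k) ^ 2 * t) * φ k x ^ 2 :=
      tsum_congr fun k => by ring
    have hterm : ∀ k, Real.exp (-(lam k) ^ 2 * t) * φ k x ^ 2 ≤
        (if k ∈ hX.freq (M / 2) then φ k x ^ 2 else 0) +
        Real.exp (-(A / 8)) * (Real.exp (-(lam k) ^ 2 * (t / 2)) * φ k x ^ 2) := by
      intro k
      split_ifs with hk
      · have h3 : Real.exp (-(lam k) ^ 2 * t) ≤ 1 := (exp_mem_Icc _ ht0.le).2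
        have h4 : 0 ≤ Real.exp (-(A / 8)) * (Real.exp (-(lam k) ^ 2 * (t / 2)) * φ k x ^ 2) := by
          positivity
        nlinarith [sq_nonneg (φ k x)]
      · rw [hX.mem_freq, not_le] at hk
        rw [zero_add, ← mul_assoc (Real.exp (-(A / 8))), ← Real.exp_add]
        refine mul_le_mul_of_nonneg_right (Real.exp_le_exp.2 ?_) (sq_nonneg _)
        have h3 : (M / 2) ^ 2 ≤ lam k ^ 2 := by gcongr
        have h4 : (M / 2) ^ 2 * (t / 2) = A / 8 := by rw [ht]; field_simp; norm_num
        nlinarith [mul_le_mul_of_nonneg_right h3 (half_pos ht0).le]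
    have hsf : Summable fun k => if k ∈ hX.freq (M / 2) then φ k x ^ 2 else 0 :=
      summable_of_ne_finset_zero (s := hX.freq (M / 2)) fun k hk => if_neg hk
    have h3 := hs.tsum_le_tsum hterm (hsf.add (hs2.mul_left _))
    rw [hsf.tsum_add (hs2.mul_left _), tsum_mul_left,
      tsum_eq_sum (s := hX.freq (M / 2)) fun k hk => if_neg hk] at h3
    have h4 : ∑ k ∈ hX.freq (M / 2), (if k ∈ hX.freq (M / 2) then φ k x ^ 2 else 0) =
        ∑ k ∈ hX.freq (M / 2), φ k x ^ 2 := Finset.sum_congr rfl fun k hk => if_pos hk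
    rw [h4, ← e1] at h3
    have h5 : (t / 2) ^ (-α / 2) = 2 ^ (α / 2) * t ^ (-α / 2) := by
      rw [Real.div_rpow ht0.le (by norm_num), neg_div, Real.rpow_neg (by norm_num : (0:ℝ) ≤ 2)]
      field_simp
    have h6 : Real.exp (-(A / 8)) * ∑' k, Real.exp (-(lam k) ^ 2 * (t / 2)) * φ k x ^ 2 ≤
        c / 2 * t ^ (-α / 2) := by
      calc _ ≤ Real.exp (-(A / 8)) * (C * (t / 2) ^ (-α / 2)) := by gcongr
        _ = (C * 2 ^ (α / 2) * Real.exp (-(A / 8))) * t ^ (-α / 2) := by rw [h5]; ring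
        _ ≤ _ := by gcongr
    have h7 : min (c / 2) 1 * t ^ (-α / 2) ≤ c / 2 * t ^ (-α / 2) := by
      gcongr; exact min_le_left _ _
    linarith
  · have h1 : (A * (M ^ 2)⁻¹) ^ (-α / 2) ≤ 1 := by
      refine Real.rpow_le_one_of_one_le_of_nonpos ?_ (by linarith)
      rw [← div_eq_mul_inv, one_le_div (by positivity)]; exact h
    calc min (c / 2) 1 * (A * (M ^ 2)⁻¹) ^ (-α / 2) ≤ 1 * 1 := by
          gcongr; exact min_le_right _ _
      _ = φ 0 x ^ 2 := by rw [hX.phi_zero]; ring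
      _ ≤ _ := by
          refine Finset.single_le_sum (f := fun k => φ k x ^ 2) (fun k _ => sq_nonneg _) ?_
          rw [hX.mem_freq, hX.lam_zero]; positivity

theorem IsDiffusionMeasureSpace.integral_sq_filterKernel
    (hX : IsDiffusionMeasureSpace ρ μ lam φ α) {H : ℝ → ℝ} (hH : IsLowPass H) {M : ℝ}
    (hM : 0 < M) (y : X) :
    ∫ z, filterKernel lam φ H M z y ^ 2 ∂μ =
      ∑ k ∈ hX.freq M, (H (lam k / M) * φ k y) ^ 2 := by
  have h1 : ∀ z, filterKernel lam φ H M z y ^ 2 = ∑ j ∈ hX.freq M, ∑ k ∈ hX.freq M,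
      (H (lam j / M) * φ j y) * (H (lam k / M) * φ k y) * (φ j z * φ k z) := by
    intro z
    rw [hX.filterKernel_eq_sum hH hM, sq, Finset.sum_mul_sum]
    exact Finset.sum_congr rfl fun j _ => Finset.sum_congr rfl fun k _ => by ring
  simp only [h1]
  rw [integral_finsetSum _ fun j _ => integrable_finsetSum _ fun k _ =>
    (hX.integrable_phi_mul_phi j k).const_mul _]
  refine Finset.sum_congr rfl fun j hj => ?_
  rw [integral_finsetSum _ fun k _ => (hX.integrable_phi_mul_phi j k).const_mul _]
  simp only [integral_const_mul, hX.integral_phi_mul_phi]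
  rw [Finset.sum_eq_single j (fun k _ hk => by simp [hk.symm]) (fun h => absurd hj h)]
  simp [sq]

theorem IsDiffusionMeasureSpace.exists_le_lintegral_sq_filterKernel
    (hX : IsDiffusionMeasureSpace ρ μ lam φ α) {H : ℝ → ℝ} (hH : IsLowPass H) :
    ∃ c : ℝ, 0 < c ∧ ∀ M : ℝ, 1 ≤ M → ∀ y,
      ENNReal.ofReal (c * M ^ α) ≤ ∫⁻ z, ENNReal.ofReal (filterKernel lam φ H M z y ^ 2) ∂μ := by
  obtain ⟨c, hc, h⟩ := hX.exists_le_sum_sq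
  refine ⟨c, hc, fun M hM y => ?_⟩
  have hM0 : 0 < M := by linarith
  have hmem : (fun z => filterKernel lam φ H M z y) ∈ diffPoly lam φ M := by
    have := hX.filterKernel_mem hH hM0 y
    convert this using 1
    ext z; exact filterKernel_symm H M z y
  rw [← ofReal_integral_eq_lintegral_ofReal _ (Eventually.of_forall fun z => sq_nonneg _),
    hX.integral_sq_filterKernel hH hM0]
  · refine ENNReal.ofReal_le_ofReal ((h M hM y).trans ?_)
    have hsub : hX.freq (M / 2) ⊆ hX.freq M := fun k hk => by
      rw [hX.mem_freq] at hk ⊢; linarith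
    refine le_trans (le_of_eq ?_)
      (Finset.sum_le_sum_of_subset_of_nonneg hsub fun k _ _ => sq_nonneg _)
    refine Finset.sum_congr rfl fun k hk => ?_
    rw [hX.mem_freq] at hk
    rw [hH.eq_one _ (div_nonneg (hX.lam_nonneg k) hM0.le), one_mul]
    rw [div_le_iff₀ hM0]; linarith
  · have h1 := hX.integrable_of_mem hmem (ν := μ) (integrable_const 1)
    simp only [one_mul] at h1
    simpa only [sq] using hX.integrable_of_mem hmem h1

/-- The `L₂` mass of the kernel is at least `c M^α`. `sq_le_add_of_le_pow`, applied to `|K| / M^α`,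
splits it into a small multiple of the weight and the weighted `q`-th power. -/
theorem IsDiffusionMeasureSpace.exists_le_lintegral_decayWeight_mul_filterKernel
    (hX : IsDiffusionMeasureSpace ρ μ lam φ α) {H : ℝ → ℝ} (hH : IsLowPass H) {m : ℕ}
    (hm : α + 1 ≤ m) {q : ℝ} (hq : 1 ≤ q) :
    ∃ c : ℝ, 0 < c ∧ ∀ M : ℝ, 1 ≤ M → ∀ y,
      ENNReal.ofReal (c * M ^ (α * q - α)) ≤
        ∫⁻ z, ENNReal.ofReal (decayWeight ρ m M y z * |filterKernel lam φ H M z y| ^ q) ∂μ := by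
  obtain ⟨c, hc, hL⟩ := hX.exists_le_lintegral_sq_filterKernel hH
  obtain ⟨C₁, hC₁, hV⟩ := hX.exists_lintegral_decayWeight_le hm
  obtain ⟨B, hB⟩ := exists_nat_ge q
  obtain ⟨C, hC, hK⟩ := hX.exists_abs_filterKernel_le hH (m * B)
  -- With this choice the weight term uses up exactly half of the `L₂` lower bound.
  set η := c / (2 * C₁) with hη
  have hη0 : 0 < η := by positivity
  set D := C ^ 2 * η ^ (-(q / 2)) with hD
  have hD0 : 0 < D := by positivity
  refine ⟨c / 2 / D, by positivity, fun M hM y => ?_⟩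
  have hM0 : 0 < M := by linarith
  have hMα : 0 < M ^ α := by positivity
  set I := ∫⁻ z, ENNReal.ofReal (decayWeight ρ m M y z * |filterKernel lam φ H M z y| ^ q) ∂μ
    with hI
  have hpt : ∀ z, filterKernel lam φ H M z y ^ 2 ≤
      (M ^ α) ^ 2 * η * decayWeight ρ m M y z + (M ^ α) ^ 2 * D * (M ^ α) ^ (-q) *
        (decayWeight ρ m M y z * |filterKernel lam φ H M z y| ^ q) := by
    intro z
    have hw := decayWeight_pos hX.quasiMetric m hM0.le y z
    set a := |filterKernel lam φ H M z y| / M ^ α with ha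
    have ha0 : 0 ≤ a := by positivity
    have haC : a ≤ C * decayWeight ρ m M y z ^ B := by
      rw [ha, div_le_iff₀ hMα, ← decayWeight_pow, decayWeight_symm hX.quasiMetric]
      have := hK M hM z y
      linarith
    have h := sq_le_add_of_le_pow (q := q) ha0 hw (decayWeight_le_one hX.quasiMetric m hM0.le y z)
      hη0 (by linarith) (by linarith) haC
    have e1 : filterKernel lam φ H M z y ^ 2 = (M ^ α) ^ 2 * a ^ 2 := by
      rw [ha, div_pow, sq_abs]; field_simp
    have e2 : a ^ q = (M ^ α) ^ (-q) * |filterKernel lam φ H M z y| ^ q := by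
      rw [ha, Real.div_rpow (abs_nonneg _) hMα.le, Real.rpow_neg hMα.le]; field_simp
    rw [e2] at h
    rw [e1]
    refine (mul_le_mul_of_nonneg_left h (by positivity)).trans (le_of_eq ?_)
    rw [hD]; ring
  have hint : ENNReal.ofReal (c * M ^ α) ≤ ENNReal.ofReal (c / 2 * M ^ α) +
      ENNReal.ofReal ((M ^ α) ^ 2 * D * (M ^ α) ^ (-q)) * I := by
    refine (hL M hM y).trans ?_
    calc _ ≤ ∫⁻ z, (ENNReal.ofReal ((M ^ α) ^ 2 * η) * ENNReal.ofReal (decayWeight ρ m M y z) +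
          ENNReal.ofReal ((M ^ α) ^ 2 * D * (M ^ α) ^ (-q)) *
          ENNReal.ofReal (decayWeight ρ m M y z * |filterKernel lam φ H M z y| ^ q)) ∂μ := by
          refine lintegral_mono fun z => ?_
          have hw := decayWeight_pos hX.quasiMetric m hM0.le y z
          rw [← ENNReal.ofReal_mul (by positivity), ← ENNReal.ofReal_mul (by positivity),
            ← ENNReal.ofReal_add (by positivity) (by positivity)]
          exact ENNReal.ofReal_le_ofReal (hpt z)
      _ = ENNReal.ofReal ((M ^ α) ^ 2 * η) * ∫⁻ z, ENNReal.ofReal (decayWeight ρ m M y z) ∂μ +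
          ENNReal.ofReal ((M ^ α) ^ 2 * D * (M ^ α) ^ (-q)) * I := by
          rw [lintegral_add_left, lintegral_const_mul', lintegral_const_mul'] <;> try simp
          exact ((hX.measurable_decayWeight m M y).ennreal_ofReal).const_mul _
      _ ≤ _ := by
          gcongr
          refine (mul_le_mul_right (hV M hM y) _).trans ?_
          rw [← ENNReal.ofReal_mul (by positivity)]
          refine ENNReal.ofReal_le_ofReal (le_of_eq ?_)
          rw [Real.rpow_neg hM0.le, hη]
          field_simp
  by_cases htop : I = ∞
  · rw [htop]; exact le_top
  rw [← ENNReal.ofReal_toReal htop, ← ENNReal.ofReal_mul (by positivity),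
    ← ENNReal.ofReal_add (by positivity) (by positivity),
    ENNReal.ofReal_le_ofReal_iff (by positivity)] at hint
  rw [← ENNReal.ofReal_toReal htop]
  refine ENNReal.ofReal_le_ofReal ?_
  have h1 : c / 2 * M ^ α ≤ (M ^ α) ^ 2 * D * (M ^ α) ^ (-q) * I.toReal := by linarith
  have e3 : M ^ (α * q - α) = (M ^ α) ^ q / M ^ α := by
    rw [Real.rpow_sub hM0, Real.rpow_mul hM0.le]
  rw [Real.rpow_neg hMα.le] at h1
  rw [e3]
  have hq0 : 0 < (M ^ α) ^ q := by positivity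
  have h2 : c / 2 * M ^ α * (M ^ α) ^ q ≤ (M ^ α) ^ 2 * D * I.toReal := by
    have := mul_le_mul_of_nonneg_right h1 hq0.le
    refine this.trans (le_of_eq ?_)
    field_simp
  rw [div_mul_div_comm, div_le_iff₀ (by positivity)]
  have h3 : c / 2 * (M ^ α) ^ q * M ^ α ≤ I.toReal * (D * M ^ α) * M ^ α := by
    calc _ = c / 2 * M ^ α * (M ^ α) ^ q := by ring
      _ ≤ _ := h2
      _ = _ := by ring
  exact le_of_mul_le_mul_right h3 hMα

/-- If a neighbourhood of `y` were null, the `L₂` mass `≥ c M^α` of `K_M(·, y)` would lie at a fixed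
distance from `y`, where localization gives `K_M² = O(M^(α - 1))`; this fails for large `M`. It
makes essential bounds of continuous functions hold everywhere, hence also for measures singular to
`μ`. -/
theorem IsDiffusionMeasureSpace.isOpenPosMeasure (hX : IsDiffusionMeasureSpace ρ μ lam φ α)
    {H : ℝ → ℝ} (hH : IsLowPass H) : μ.IsOpenPosMeasure := by
  refine ⟨fun U hU ⟨y, hy⟩ hU0 => ?_⟩
  obtain ⟨t, ht, hsub⟩ := (hX.isOpen_iff U).1 hU y hy
  have hα := hX.alpha_pos
  obtain ⟨m, hm⟩ := exists_nat_ge (α + 1)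
  obtain ⟨c, hc, hL⟩ := hX.exists_le_lintegral_sq_filterKernel hH
  obtain ⟨C, hC, hK⟩ := hX.exists_abs_filterKernel_le hH m
  set t₁ := min t 1 with ht₁
  have ht₁0 : 0 < t₁ := lt_min ht one_pos
  have key : ∀ M : ℝ, 1 ≤ M → c ≤ C ^ 2 * (t₁ ^ m)⁻¹ * M⁻¹ := by
    intro M hM
    have hM0 : 0 < M := by linarith
    have hMα : 0 < M ^ α := by positivity
    have hb : ∀ᵐ z ∂μ, ENNReal.ofReal (filterKernel lam φ H M z y ^ 2) ≤
        ENNReal.ofReal (C ^ 2 * (t₁ ^ m)⁻¹ * M⁻¹ * M ^ α) := by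
      have : ∀ᵐ z ∂μ, z ∉ U := measure_eq_zero_iff_ae_notMem.1 hU0
      filter_upwards [this] with z hz
      refine ENNReal.ofReal_le_ofReal ?_
      have hρ : t ≤ ρ z y := by
        rw [hX.quasiMetric.symm]; by_contra h; exact hz (hsub (not_le.1 h))
      have hw1 := decayWeight_le_one hX.quasiMetric m hM0.le z y
      have hw0 := decayWeight_pos hX.quasiMetric m hM0.le z y
      have hw : decayWeight ρ m M z y ≤ (t₁ ^ m)⁻¹ * (M ^ m)⁻¹ := by
        rw [decayWeight, ← mul_inv, ← mul_pow]
        have : t₁ ≤ min (ρ z y) 1 := min_le_min_right 1 hρ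
        gcongr
        nlinarith
      have hMm : M * M ^ α ≤ M ^ m := by
        rw [← Real.rpow_natCast, mul_comm, ← Real.rpow_add_one hM0.ne']
        exact Real.rpow_le_rpow_of_exponent_le hM hm
      calc filterKernel lam φ H M z y ^ 2 = |filterKernel lam φ H M z y| ^ 2 := (sq_abs _).symm
        _ ≤ (C * M ^ α * decayWeight ρ m M z y) ^ 2 := by gcongr; exact hK M hM z y
        _ = C ^ 2 * (M ^ α) ^ 2 * (decayWeight ρ m M z y * decayWeight ρ m M z y) := by ring
        _ ≤ C ^ 2 * (M ^ α) ^ 2 * (1 * ((t₁ ^ m)⁻¹ * (M ^ m)⁻¹)) := by gcongr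
        _ ≤ C ^ 2 * (M ^ α) ^ 2 * (1 * ((t₁ ^ m)⁻¹ * (M * M ^ α)⁻¹)) := by gcongr
        _ = _ := by field_simp
    have h := (hL M hM y).trans (lintegral_mono_ae hb)
    rw [lintegral_const, measure_univ, mul_one, ENNReal.ofReal_le_ofReal_iff (by positivity)] at h
    exact le_of_mul_le_mul_right h hMα
  set D := C ^ 2 * (t₁ ^ m)⁻¹ with hD
  have hD0 : 0 < D := by positivity
  have h := key (max 1 (2 * D / c)) (le_max_left _ _)
  have h2 : D * (max 1 (2 * D / c))⁻¹ ≤ c / 2 := by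
    rw [← div_eq_mul_inv, div_le_iff₀ (by positivity)]
    have := le_max_right 1 (2 * D / c)
    rw [div_le_iff₀ hc] at this
    linarith
  linarith

end DiffusionSpace

/-! ### Regularity of Marcinkiewicz-Zygmund measures -/

namespace DiffusionSpace

variable {X : Type*} {ρ : X → X → ℝ} {lam : ℕ → ℝ} {φ : ℕ → X → ℝ} {α : ℝ}

theorem decayWeight_anti (hρ : IsQuasiMetric ρ) (m : ℕ) {M M' : ℝ} (hM : 0 ≤ M) (h : M ≤ M')
    (x y : X) : decayWeight ρ m M' x y ≤ decayWeight ρ m M x y := by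
  have h0 := le_min (hρ.nonneg x y) zero_le_one
  have := mul_nonneg hM h0
  unfold decayWeight
  gcongr

theorem lintegral_rpow_le_of_eLpNorm_le [MeasurableSpace X] {p : ℝ≥0∞} (hp : 1 ≤ p)
    (hp' : p ≠ ∞) {P : X → ℝ}
    {μ ν : Measure X} {C : ℝ} (hC : 0 ≤ C)
    (h : eLpNorm P p ν ≤ ENNReal.ofReal C * eLpNorm P p μ) :
    ∫⁻ y, ENNReal.ofReal (|P y| ^ p.toReal) ∂ν ≤
      ENNReal.ofReal (C ^ p.toReal) * ∫⁻ y, ENNReal.ofReal (|P y| ^ p.toReal) ∂μ := by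
  have hp0 : p ≠ 0 := (zero_lt_one.trans_le hp).ne'
  have hpt : 0 < p.toReal := ENNReal.toReal_pos hp0 hp'
  have e : ∀ y, ENNReal.ofReal (|P y| ^ p.toReal) = ‖P y‖ₑ ^ p.toReal := fun y => by
    rw [← ENNReal.ofReal_rpow_of_nonneg (abs_nonneg _) hpt.le, Real.enorm_eq_ofReal_abs]
  simp only [e]
  rw [eLpNorm_eq_lintegral_rpow_enorm_toReal hp0 hp',
    eLpNorm_eq_lintegral_rpow_enorm_toReal hp0 hp'] at h
  have h2 := ENNReal.rpow_le_rpow h hpt.le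
  rw [ENNReal.mul_rpow_of_nonneg _ _ hpt.le, ← ENNReal.rpow_mul, ← ENNReal.rpow_mul,
    one_div_mul_cancel hpt.ne', ENNReal.rpow_one, ENNReal.rpow_one,
    ENNReal.ofReal_rpow_of_nonneg hC hpt.le] at h2
  exact h2

variable [TopologicalSpace X] [MeasurableSpace X] [BorelSpace X]
  {μ : Measure X} [IsProbabilityMeasure μ]

theorem IsDiffusionMeasureSpace.measurable_filterKernel
    (hX : IsDiffusionMeasureSpace ρ μ lam φ α) {H : ℝ → ℝ} (hH : IsLowPass H) {M : ℝ}
    (hM : 0 < M) : Measurable fun p : X × X => filterKernel lam φ H M p.1 p.2 := by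
  simp only [hX.filterKernel_eq_sum hH hM]
  refine Finset.measurable_fun_sum _ fun k _ => ?_
  have := (hX.continuous_phi k).measurable
  fun_prop

theorem IsDiffusionMeasureSpace.exists_lintegral_filterKernel_rpow_le
    (hX : IsDiffusionMeasureSpace ρ μ lam φ α) {H : ℝ → ℝ} (hH : IsLowPass H) {q : ℝ}
    (hq : 1 ≤ q) :
    ∃ C : ℝ, 0 < C ∧ ∀ M : ℝ, 1 ≤ M → ∀ x,
      ∫⁻ y, ENNReal.ofReal (|filterKernel lam φ H M x y| ^ q) ∂μ ≤
        ENNReal.ofReal (C * M ^ (α * q - α)) := by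
  obtain ⟨m, hm⟩ := exists_nat_ge (α + 1)
  obtain ⟨C₁, hC₁, hV⟩ := hX.exists_lintegral_decayWeight_le hm
  obtain ⟨C, hC, hK⟩ := hX.exists_abs_filterKernel_le hH m
  refine ⟨C ^ q * C₁, by positivity, fun M hM x => ?_⟩
  have hM0 : 0 < M := by linarith
  have hMα : 0 < M ^ α := by positivity
  calc _ ≤ ∫⁻ y, ENNReal.ofReal ((C * M ^ α) ^ q) * ENNReal.ofReal (decayWeight ρ m M x y) ∂μ := by
        refine lintegral_mono fun y => ?_
        have hw := decayWeight_pos hX.quasiMetric m hM0.le x y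
        rw [← ENNReal.ofReal_mul (by positivity)]
        refine ENNReal.ofReal_le_ofReal ?_
        calc |filterKernel lam φ H M x y| ^ q ≤ (C * M ^ α * decayWeight ρ m M x y) ^ q := by
              gcongr; exact hK M hM x y
          _ = (C * M ^ α) ^ q * decayWeight ρ m M x y ^ q :=
              Real.mul_rpow (by positivity) hw.le
          _ ≤ (C * M ^ α) ^ q * decayWeight ρ m M x y ^ (1 : ℝ) := by
              gcongr ?_ * ?_
              exact Real.rpow_le_rpow_of_exponent_ge hw
                (decayWeight_le_one hX.quasiMetric m hM0.le x y) hq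
          _ = _ := by rw [Real.rpow_one]
    _ = ENNReal.ofReal ((C * M ^ α) ^ q) * ∫⁻ y, ENNReal.ofReal (decayWeight ρ m M x y) ∂μ :=
        lintegral_const_mul' _ _ ENNReal.ofReal_ne_top
    _ ≤ ENNReal.ofReal ((C * M ^ α) ^ q) * ENNReal.ofReal (C₁ * M ^ (-α)) :=
        mul_le_mul_right (hV M hM x) _
    _ = _ := by
        rw [← ENNReal.ofReal_mul (by positivity), Real.mul_rpow hC.le hMα.le, ← Real.rpow_mul hM0.le,
          sub_eq_add_neg, Real.rpow_add hM0]
        congr 1; ring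

/-- A measure that satisfies an upper Marcinkiewicz-Zygmund inequality on `Π_M` for some finite
exponent is regular at scale `1 / M`. -/
theorem IsDiffusionMeasureSpace.exists_lintegral_decayWeight_le_of_rpow_le
    (hX : IsDiffusionMeasureSpace ρ μ lam φ α) {H : ℝ → ℝ} (hH : IsLowPass H) {m : ℕ}
    (hm : α + 1 ≤ m) {q : ℝ} (hq : 1 ≤ q) {A : ℝ} (hA : 0 < A) :
    ∃ C : ℝ, 0 < C ∧ ∀ M : ℝ, 1 ≤ M → ∀ ν : Measure X, IsFiniteMeasure ν →
      (∀ P ∈ diffPoly lam φ M, ∫⁻ y, ENNReal.ofReal (|P y| ^ q) ∂ν ≤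
        ENNReal.ofReal A * ∫⁻ y, ENNReal.ofReal (|P y| ^ q) ∂μ) →
      ∀ x, ∫⁻ y, ENNReal.ofReal (decayWeight ρ m M x y) ∂ν ≤ ENNReal.ofReal (C * M ^ (-α)) := by
  obtain ⟨C₁, hC₁, hV⟩ := hX.exists_lintegral_decayWeight_le hm
  obtain ⟨C₂, hC₂, hK⟩ := hX.exists_lintegral_filterKernel_rpow_le hH hq
  obtain ⟨c, hc, hL⟩ := hX.exists_le_lintegral_decayWeight_mul_filterKernel hH hm hq
  obtain ⟨κ, hκ, hslow⟩ := hX.quasiMetric.exists_decayWeight_mul_le m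
  refine ⟨κ / c * (A * C₂ * C₁), by positivity, fun M hM ν hν hMZ x => ?_⟩
  have hM0 : 0 < M := by linarith
  have hw := fun a b => decayWeight_pos hX.quasiMetric m hM0.le a b
  set J := ∫⁻ y, ENNReal.ofReal (decayWeight ρ m M x y) ∂ν with hJ
  set Kq : X → X → ℝ := fun z y => |filterKernel lam φ H M z y| ^ q with hKq
  have hKq0 : ∀ z y, 0 ≤ Kq z y := fun z y => by positivity
  have hKm : Measurable fun p : X × X => Kq p.1 p.2 :=
    ((hX.measurable_filterKernel hH hM0).abs.pow_const q)
  set b := c * M ^ (α * q - α) / κ with hb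
  have hb0 : 0 < b := by positivity
  -- The lower bound at `y` and the slow variation of the weights replace `w(x, y)` by an average
  -- over `z` of `w(x, z) |K(z, y)|^q`.
  have hlow : ENNReal.ofReal b * J ≤
      ∫⁻ y, ∫⁻ z, ENNReal.ofReal (decayWeight ρ m M x z * Kq z y) ∂μ ∂ν := by
    rw [hJ, ← lintegral_const_mul' _ _ ENNReal.ofReal_ne_top]
    refine lintegral_mono fun y => ?_
    calc ENNReal.ofReal b * ENNReal.ofReal (decayWeight ρ m M x y)
        = ENNReal.ofReal (decayWeight ρ m M x y / κ) *
            ENNReal.ofReal (c * M ^ (α * q - α)) := by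
          have := hw x y
          rw [← ENNReal.ofReal_mul hb0.le, ← ENNReal.ofReal_mul (by positivity), hb]
          congr 1; ring
      _ ≤ ENNReal.ofReal (decayWeight ρ m M x y / κ) *
            ∫⁻ z, ENNReal.ofReal (decayWeight ρ m M y z * Kq z y) ∂μ :=
          mul_le_mul_right (hL M hM y) _
      _ = ∫⁻ z, ENNReal.ofReal (decayWeight ρ m M x y / κ) *
            ENNReal.ofReal (decayWeight ρ m M y z * Kq z y) ∂μ :=
          (lintegral_const_mul' _ _ ENNReal.ofReal_ne_top).symm
      _ ≤ _ := by
          refine lintegral_mono fun z => ?_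
          have := hw x y
          rw [← ENNReal.ofReal_mul (by positivity)]
          refine ENNReal.ofReal_le_ofReal ?_
          have h := hslow M hM0.le x y z
          calc _ = (decayWeight ρ m M x y * decayWeight ρ m M y z) / κ * Kq z y := by ring
            _ ≤ decayWeight ρ m M x z * Kq z y := by
                refine mul_le_mul_of_nonneg_right ?_ (hKq0 z y)
                rw [div_le_iff₀ hκ]; linarith
  -- For fixed `z`, the kernel `K(z, ·)` belongs to `Π_M`, so the hypothesis on `ν` moves the inner
  -- integral to `μ`, where row bounds are known.
  have hup : ∫⁻ z, ∫⁻ y, ENNReal.ofReal (decayWeight ρ m M x z * Kq z y) ∂ν ∂μ ≤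
      ENNReal.ofReal (A * (C₂ * M ^ (α * q - α)) * (C₁ * M ^ (-α))) := by
    calc _ ≤ ∫⁻ z, ENNReal.ofReal (A * (C₂ * M ^ (α * q - α))) *
          ENNReal.ofReal (decayWeight ρ m M x z) ∂μ := by
          refine lintegral_mono fun z => ?_
          simp only [ENNReal.ofReal_mul (hw x z).le]
          rw [lintegral_const_mul' _ _ ENNReal.ofReal_ne_top, mul_comm]
          refine mul_le_mul_left ?_ _
          rw [ENNReal.ofReal_mul hA.le]
          exact (hMZ _ (hX.filterKernel_mem hH hM0 z)).trans (mul_le_mul_right (hK M hM z) _)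
      _ = _ := lintegral_const_mul' _ _ ENNReal.ofReal_ne_top
      _ ≤ _ := by
          rw [ENNReal.ofReal_mul (p := A * (C₂ * M ^ (α * q - α))) (by positivity)]
          exact mul_le_mul_right (hV M hM x) _
  have hswap : ∫⁻ y, ∫⁻ z, ENNReal.ofReal (decayWeight ρ m M x z * Kq z y) ∂μ ∂ν =
      ∫⁻ z, ∫⁻ y, ENNReal.ofReal (decayWeight ρ m M x z * Kq z y) ∂ν ∂μ := by
    refine lintegral_lintegral_swap (Measurable.aemeasurable ?_)
    refine Measurable.ennreal_ofReal ?_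
    exact ((hX.measurable_decayWeight m M x).comp measurable_snd).mul (hKm.comp measurable_swap)
  calc J = ENNReal.ofReal b⁻¹ * (ENNReal.ofReal b * J) := by
        rw [← mul_assoc, ← ENNReal.ofReal_mul (by positivity), inv_mul_cancel₀ hb0.ne',
          ENNReal.ofReal_one, one_mul]
    _ ≤ ENNReal.ofReal b⁻¹ * ENNReal.ofReal (A * (C₂ * M ^ (α * q - α)) * (C₁ * M ^ (-α))) :=
        mul_le_mul_right ((hlow.trans hswap.le).trans hup) _
    _ = _ := by
        rw [← ENNReal.ofReal_mul (by positivity), hb]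
        congr 1
        have : M ^ (α * q - α) ≠ 0 := by positivity
        field_simp

theorem IsDiffusionMeasureSpace.one_mem (hX : IsDiffusionMeasureSpace ρ μ lam φ α) {M : ℝ}
    (hM : 0 ≤ M) : (1 : X → ℝ) ∈ diffPoly lam φ M := by
  have : (1 : X → ℝ) = φ 0 := by ext x; simp [hX.phi_zero]
  rw [this]
  exact phi_mem_diffPoly (by rwa [hX.lam_zero])

theorem StrongProduct.diffPoly_le (hX : IsDiffusionMeasureSpace ρ μ lam φ α) {a : ℝ}
    (ha : StrongProduct lam φ a) (n : ℕ) :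
    diffPoly lam φ (2 * (2 : ℝ) ^ n) ≤ diffPoly lam φ (a * (2 : ℝ) ^ n) := by
  intro g hg
  have := ha.2 n 1 (hX.one_mem (by positivity)) g hg
  rwa [one_mul] at this

/-- The regularity argument needs one finite exponent: `q = p` if `p < ∞`, and `q = 1` if `p = ∞`,
where the additional `L₁` bound enters. -/
theorem IsUniformMZQuadrature.exists_lintegral_rpow_le (hX : IsDiffusionMeasureSpace ρ μ lam φ α)
    {a : ℝ} (ha : StrongProduct lam φ a) {p : ℝ≥0∞} (hp : 1 ≤ p) {ν : ℕ → SignedMeasure X}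
    (hν : IsUniformMZQuadrature μ lam φ a p ν) :
    ∃ q A : ℝ, 1 ≤ q ∧ 0 < A ∧ ∀ n, ∀ P ∈ diffPoly lam φ ((2 : ℝ) ^ n),
      ∫⁻ y, ENNReal.ofReal (|P y| ^ q) ∂(ν n).totalVariation ≤
        ENNReal.ofReal A * ∫⁻ y, ENNReal.ofReal (|P y| ^ q) ∂μ := by
  obtain ⟨-, c, C, hc, hC, h⟩ := hν
  have hsub : ∀ n, diffPoly lam φ ((2 : ℝ) ^ n) ≤ diffPoly lam φ (a * (2 : ℝ) ^ n) := fun n =>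
    (diffPoly_mono (by linarith [pow_pos (zero_lt_two' ℝ) n])).trans (ha.diffPoly_le hX n)
  by_cases hp' : p = ∞
  · refine ⟨1, C, le_rfl, hC, fun n P hP => ?_⟩
    have := lintegral_rpow_le_of_eLpNorm_le le_rfl ENNReal.one_ne_top hC.le
      ((h n P (hsub n hP)).2.2 hp')
    simpa using this
  · refine ⟨p.toReal, C ^ p.toReal, ?_, by positivity, fun n P hP =>
      lintegral_rpow_le_of_eLpNorm_le hp hp' hC.le (h n P (hsub n hP)).2.1⟩
    rw [← ENNReal.toReal_one]
    exact ENNReal.toReal_mono hp' hp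

/-- The kernels are uniformly integrable against uniform families of quadrature measures, and
these have bounded mass. -/
theorem IsUniformMZQuadrature.exists_lintegral_kernel_le
    (hX : IsDiffusionMeasureSpace ρ μ lam φ α) {H : ℝ → ℝ} (hH : IsLowPass H)
    {a : ℝ} (ha : StrongProduct lam φ a) {p : ℝ≥0∞} (hp : 1 ≤ p) {ν : ℕ → SignedMeasure X}
    (hν : IsUniformMZQuadrature μ lam φ a p ν) :
    ∃ C : ℝ, 0 < C ∧ ∀ n,
      (ν n).totalVariation univ ≤ ENNReal.ofReal C ∧
      (∀ x, ∫⁻ y, ‖filterKernel lam φ H ((2 : ℝ) ^ n) x y‖ₑ ∂(ν n).totalVariation ≤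
        ENNReal.ofReal C) ∧
      (∀ x, ∫⁻ y, ‖filterKernel lam φ H (2 * (2 : ℝ) ^ n) x y‖ₑ ∂(ν n).totalVariation ≤
        ENNReal.ofReal C) := by
  obtain ⟨q, A, hq, hA, hMZ⟩ := hν.exists_lintegral_rpow_le hX ha hp
  obtain ⟨m, hm⟩ := exists_nat_ge (α + 1)
  obtain ⟨C₁, hC₁, hreg⟩ := hX.exists_lintegral_decayWeight_le_of_rpow_le hH hm hq hA
  obtain ⟨C₂, hC₂, hK⟩ := hX.exists_abs_filterKernel_le hH m
  have hα := hX.alpha_pos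
  have hkey : ∀ n x, ∀ F : X → ℝ,
      (∀ y, |F y| ≤ C₂ * 2 ^ α * ((2 : ℝ) ^ n) ^ α * decayWeight ρ m ((2 : ℝ) ^ n) x y) →
      ∫⁻ y, ‖F y‖ₑ ∂(ν n).totalVariation ≤ ENNReal.ofReal (C₂ * 2 ^ α * C₁) := by
    intro n x F hF
    have hN : (1 : ℝ) ≤ 2 ^ n := one_le_pow₀ (by norm_num)
    have hN0 : (0 : ℝ) < 2 ^ n := by positivity
    calc _ ≤ ∫⁻ y, ENNReal.ofReal (C₂ * 2 ^ α * ((2 : ℝ) ^ n) ^ α) *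
          ENNReal.ofReal (decayWeight ρ m ((2 : ℝ) ^ n) x y) ∂(ν n).totalVariation := by
          refine lintegral_mono fun y => ?_
          rw [Real.enorm_eq_ofReal_abs, ← ENNReal.ofReal_mul (by positivity)]
          exact ENNReal.ofReal_le_ofReal (hF y)
      _ = _ := lintegral_const_mul' _ _ ENNReal.ofReal_ne_top
      _ ≤ ENNReal.ofReal (C₂ * 2 ^ α * ((2 : ℝ) ^ n) ^ α) *
          ENNReal.ofReal (C₁ * ((2 : ℝ) ^ n) ^ (-α)) :=
          mul_le_mul_right (hreg _ hN _ inferInstance (hMZ n) x) _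
      _ = _ := by
          rw [← ENNReal.ofReal_mul (by positivity), Real.rpow_neg hN0.le]
          congr 1; field_simp
  have h2α : (1 : ℝ) ≤ 2 ^ α := Real.one_le_rpow (by norm_num) hα.le
  refine ⟨max A (C₂ * 2 ^ α * C₁), by positivity, fun n => ⟨?_, fun x => ?_, fun x => ?_⟩⟩
  · have := hMZ n 1 (hX.one_mem (by positivity))
    simp only [Pi.one_apply, abs_one, Real.one_rpow, ENNReal.ofReal_one, lintegral_const, one_mul,
      measure_univ, mul_one] at this
    exact this.trans (ENNReal.ofReal_le_ofReal (le_max_left _ _))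
  · refine (hkey n x _ fun y => ?_).trans (ENNReal.ofReal_le_ofReal (le_max_right _ _))
    have hN : (1 : ℝ) ≤ 2 ^ n := one_le_pow₀ (by norm_num)
    have hw := decayWeight_pos hX.quasiMetric m (by positivity : (0 : ℝ) ≤ 2 ^ n) x y
    refine (hK _ hN x y).trans ?_
    gcongr
    nlinarith
  -- The kernel of order `2N` is compared with the weight at scale `N`, the one for which regularity
  -- is at hand; this costs the factor `2 ^ α`.
  · refine (hkey n x _ fun y => ?_).trans (ENNReal.ofReal_le_ofReal (le_max_right _ _))
    have hN : (1 : ℝ) ≤ 2 ^ n := one_le_pow₀ (by norm_num)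
    refine (hK _ (by linarith) x y).trans ?_
    rw [Real.mul_rpow (by norm_num) (by positivity), ← mul_assoc]
    gcongr
    exact decayWeight_anti hX.quasiMetric m (by positivity) (by linarith) x y

end DiffusionSpace

/-! ### Schur's test, signed integrals and reproduction of polynomials -/

namespace DiffusionSpace

section Schur

variable {X : Type*} [MeasurableSpace X]

/-- Schur's test for kernels with uniformly bounded rows and columns. -/
theorem eLpNorm_le_of_enorm_le_lintegral_kernel {μ : Measure X} [SFinite μ] {p : ℝ≥0∞}
    (hp : 1 ≤ p) (hp' : p ≠ ∞) {K : X → X → ℝ} (hK : Measurable fun z : X × X => K z.1 z.2)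
    {C : ℝ≥0∞} (hC : C ≠ 0) (hCt : C ≠ ∞)
    (h1 : ∀ x, ∫⁻ y, ‖K x y‖ₑ ∂μ ≤ C) (h2 : ∀ y, ∫⁻ x, ‖K x y‖ₑ ∂μ ≤ C)
    {h T : X → ℝ} (hh : AEStronglyMeasurable h μ)
    (hT : ∀ x, ‖T x‖ₑ ≤ ∫⁻ y, ‖h y * K x y‖ₑ ∂μ) :
    eLpNorm T p μ ≤ C * eLpNorm h p μ := by
  have hp0 : p ≠ 0 := (zero_lt_one.trans_le hp).ne'
  have hq0 : 0 < p.toReal := ENNReal.toReal_pos hp0 hp'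
  have hq1 : 1 ≤ p.toReal := by
    rw [← ENNReal.toReal_one]; exact ENNReal.toReal_mono hp' hp
  set q := p.toReal with hq
  have hKx : ∀ x, Measurable fun y => ‖K x y‖ₑ := fun x =>
    (hK.comp measurable_prodMk_left).enorm
  have hpt : ∀ x, ‖T x‖ₑ ^ q ≤ C ^ (q - 1) * ∫⁻ y, ‖K x y‖ₑ * ‖h y‖ₑ ^ q ∂μ := by
    intro x
    -- Jensen's inequality for the measure `|K(x, ·)| μ`, of mass at most `C`, yields the factor
    -- `C^(q - 1)`; the column bound after Tonelli yields the last `C`.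
    set ν := μ.withDensity fun y => ‖K x y‖ₑ with hν
    have hhν : AEStronglyMeasurable h ν :=
      hh.mono_ac (withDensity_absolutelyContinuous _ _)
    have hl : ∀ g : X → ℝ≥0∞, AEMeasurable g μ → ∫⁻ y, g y ∂ν = ∫⁻ y, ‖K x y‖ₑ * g y ∂μ := by
      intro g hg
      rw [hν, lintegral_withDensity_eq_lintegral_mul₀ (hKx x).aemeasurable hg]; rfl
    have hmass : ν univ ≤ C := by
      rw [hν, withDensity_apply _ MeasurableSet.univ, Measure.restrict_univ]; exact h1 x
    have hJ := eLpNorm_le_eLpNorm_mul_rpow_measure_univ hp hhν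
    rw [eLpNorm_one_eq_lintegral_enorm, eLpNorm_eq_lintegral_rpow_enorm_toReal hp0 hp',
      ENNReal.toReal_one, hl _ hh.enorm, hl _ (hh.enorm.pow_const _), ← hq] at hJ
    calc ‖T x‖ₑ ^ q ≤ (∫⁻ y, ‖K x y‖ₑ * ‖h y‖ₑ ∂μ) ^ q := by
          refine ENNReal.rpow_le_rpow ((hT x).trans (le_of_eq ?_)) hq0.le
          exact lintegral_congr fun y => by rw [enorm_mul, mul_comm]
      _ ≤ ((∫⁻ y, ‖K x y‖ₑ * ‖h y‖ₑ ^ q ∂μ) ^ (1 / q) * ν univ ^ (1 / 1 - 1 / q)) ^ q :=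
          ENNReal.rpow_le_rpow hJ hq0.le
      _ = ν univ ^ (q - 1) * ∫⁻ y, ‖K x y‖ₑ * ‖h y‖ₑ ^ q ∂μ := by
          rw [ENNReal.mul_rpow_of_nonneg _ _ hq0.le, ← ENNReal.rpow_mul, ← ENNReal.rpow_mul,
            one_div_mul_cancel hq0.ne', ENNReal.rpow_one, mul_comm]
          congr 2; field_simp
      _ ≤ _ := by
          gcongr
  rw [eLpNorm_eq_lintegral_rpow_enorm_toReal hp0 hp',
    eLpNorm_eq_lintegral_rpow_enorm_toReal hp0 hp', ← hq]
  have hmeas : AEMeasurable (Function.uncurry fun x y => ‖K x y‖ₑ * ‖h y‖ₑ ^ q) (μ.prod μ) := by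
    refine hK.enorm.aemeasurable.mul ?_
    exact ((hh.enorm.comp_quasiMeasurePreserving
      Measure.quasiMeasurePreserving_snd).pow_const q)
  have hint : ∫⁻ x, ‖T x‖ₑ ^ q ∂μ ≤ C ^ q * ∫⁻ y, ‖h y‖ₑ ^ q ∂μ := by
    calc _ ≤ ∫⁻ x, C ^ (q - 1) * ∫⁻ y, ‖K x y‖ₑ * ‖h y‖ₑ ^ q ∂μ ∂μ := lintegral_mono hpt
      _ = C ^ (q - 1) * ∫⁻ x, ∫⁻ y, ‖K x y‖ₑ * ‖h y‖ₑ ^ q ∂μ ∂μ :=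
          lintegral_const_mul' _ _ (ENNReal.rpow_ne_top_of_nonneg (by linarith) hCt)
      _ = C ^ (q - 1) * ∫⁻ y, ∫⁻ x, ‖K x y‖ₑ * ‖h y‖ₑ ^ q ∂μ ∂μ := by
          rw [lintegral_lintegral_swap hmeas]
      _ ≤ C ^ (q - 1) * ∫⁻ y, C * ‖h y‖ₑ ^ q ∂μ := by
          gcongr with y
          have hKy : Measurable fun x => ‖K x y‖ₑ := (hK.comp measurable_prodMk_right).enorm
          rw [lintegral_mul_const _ hKy]
          gcongr
          exact h2 y
      _ = _ := by
          rw [lintegral_const_mul' _ _ hCt, ← mul_assoc]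
          congr 1
          conv_lhs => rw [← ENNReal.rpow_one C, ← ENNReal.rpow_mul, one_mul]
          rw [← ENNReal.rpow_add _ _ hC hCt, sub_add_cancel]
  calc _ ≤ (C ^ q * ∫⁻ y, ‖h y‖ₑ ^ q ∂μ) ^ (1 / q) := ENNReal.rpow_le_rpow hint (by positivity)
    _ = _ := by
      rw [ENNReal.mul_rpow_of_nonneg _ _ (by positivity), ← ENNReal.rpow_mul,
        mul_one_div_cancel hq0.ne', ENNReal.rpow_one]

end Schur

section SignedIntegral

variable {X : Type*} [MeasurableSpace X]

theorem enorm_signed_integral_le (ν : SignedMeasure X) (f : X → ℝ) :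
    ‖∫ᵛ y, f y ∂•ν‖ₑ ≤ ∫⁻ y, ‖f y‖ₑ ∂ν.totalVariation := by
  rw [SignedMeasure.totalVariation_eq_variation]
  refine VectorMeasure.enorm_integral_le_lintegral_enorm.trans ?_
  refine mul_le_of_le_one_left zero_le ?_
  have : ‖(ContinuousLinearMap.lsmul ℝ ℝ : ℝ →L[ℝ] ℝ →L[ℝ] ℝ)‖ ≤ 1 :=
    ContinuousLinearMap.opNorm_lsmul_le
  rw [← ofReal_norm]
  exact ENNReal.ofReal_le_one.2 this

theorem signed_integral_toSignedMeasure (μ : Measure X) [IsFiniteMeasure μ] (f : X → ℝ) :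
    ∫ᵛ y, f y ∂•μ.toSignedMeasure = ∫ y, f y ∂μ := by
  rw [← VectorMeasure.integral_toSignedMeasure]
  congr 1
  ext; simp

theorem signed_integral_const_mul (ν : SignedMeasure X) (c : ℝ) (f : X → ℝ) :
    ∫ᵛ y, c * f y ∂•ν = c * ∫ᵛ y, f y ∂•ν :=
  VectorMeasure.integral_fun_smul ν _ c f

theorem signed_integral_finsetSum (ν : SignedMeasure X) {ι : Type*} (s : Finset ι)
    {f : ι → X → ℝ} (hf : ∀ i ∈ s, Integrable (f i) ν.totalVariation) :
    ∫ᵛ y, ∑ i ∈ s, f i y ∂•ν = ∑ i ∈ s, ∫ᵛ y, f i y ∂•ν := by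
  rw [SignedMeasure.totalVariation_eq_variation] at hf
  exact VectorMeasure.integral_finsetSum s hf

theorem signed_integral_sub (ν : SignedMeasure X) {f g : X → ℝ}
    (hf : Integrable f ν.totalVariation) (hg : Integrable g ν.totalVariation) :
    ∫ᵛ y, (f y - g y) ∂•ν = ∫ᵛ y, f y ∂•ν - ∫ᵛ y, g y ∂•ν := by
  rw [SignedMeasure.totalVariation_eq_variation] at hf hg
  exact VectorMeasure.integral_fun_sub hf hg

theorem enorm_signed_setIntegral_compl_le (ν : SignedMeasure X) {B : Set X}
    (hB : MeasurableSet B) {f : X → ℝ} (hf : Integrable f ν.totalVariation) :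
    ‖∫ᵛ y, f y ∂•ν - ∫ᵛ y in B, f y ∂•ν‖ₑ ≤ ∫⁻ y in Bᶜ, ‖f y‖ₑ ∂ν.totalVariation := by
  have hf' := hf
  rw [SignedMeasure.totalVariation_eq_variation] at hf'
  rw [← VectorMeasure.setIntegral_compl hB hf', ← VectorMeasure.integral_indicator hB.compl]
  refine (enorm_signed_integral_le ν _).trans (le_of_eq ?_)
  rw [← lintegral_indicator hB.compl]
  refine lintegral_congr fun y => ?_
  rw [enorm_indicator_eq_indicator_enorm]

end SignedIntegral

theorem enorm_le_eLpNorm_top {X : Type*} [TopologicalSpace X] [MeasurableSpace X]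
    {μ : Measure X} [μ.IsOpenPosMeasure] {h : X → ℝ} (hh : Continuous h) (x : X) :
    ‖h x‖ₑ ≤ eLpNorm h ∞ μ := by
  by_contra hx
  rw [not_le] at hx
  have hopen : IsOpen {y | eLpNorm h ∞ μ < ‖h y‖ₑ} :=
    isOpen_Ioi.preimage hh.enorm
  have hnull : μ {y | eLpNorm h ∞ μ < ‖h y‖ₑ} = 0 := by
    have := ae_le_eLpNormEssSup (f := h) (μ := μ)
    rw [eLpNorm_exponent_top]
    simpa [ae_iff] using this
  have := (hopen.measure_eq_zero_iff μ).1 hnull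
  exact (Set.ext_iff.1 this x).1 hx

variable {X : Type*} {ρ : X → X → ℝ} {lam : ℕ → ℝ} {φ : ℕ → X → ℝ} {α : ℝ}
  [TopologicalSpace X] [MeasurableSpace X] [BorelSpace X]
  {μ : Measure X} [IsProbabilityMeasure μ]

theorem IsDiffusionMeasureSpace.sigma_eq_integral (hX : IsDiffusionMeasureSpace ρ μ lam φ α)
    {H : ℝ → ℝ} (hH : IsLowPass H) {M : ℝ} (hM : 0 < M) {ν : SignedMeasure X} {f : X → ℝ}
    (hf : Integrable f ν.totalVariation) (x : X) :
    sigma lam φ H M f ν x = ∫ᵛ y, f y * filterKernel lam φ H M x y ∂•ν := by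
  have h1 : sigma lam φ H M f ν x = ∑ k ∈ hX.freq M,
      (H (lam k / M) * φ k x) * ∫ᵛ y, f y * φ k y ∂•ν := by
    rw [sigma, tsum_eq_sum (s := hX.freq M) fun k hk => by rw [hX.filter_eq_zero hH hM hk]; ring]
    exact Finset.sum_congr rfl fun k _ => by ring
  have h2 : ∀ y, f y * filterKernel lam φ H M x y = ∑ k ∈ hX.freq M,
      (H (lam k / M) * φ k x) * (f y * φ k y) := by
    intro y
    rw [hX.filterKernel_eq_sum hH hM, Finset.mul_sum]
    exact Finset.sum_congr rfl fun k _ => by ring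
  simp only [h1, h2]
  rw [signed_integral_finsetSum]
  · exact Finset.sum_congr rfl fun k _ => (signed_integral_const_mul _ _ _).symm
  · intro k _
    exact (hX.integrable_of_mem (phi_mem_diffPoly (le_refl (lam k))) hf).const_mul _

theorem IsDiffusionMeasureSpace.sigma_mem (hX : IsDiffusionMeasureSpace ρ μ lam φ α)
    {H : ℝ → ℝ} (hH : IsLowPass H) {M : ℝ} (hM : 0 < M) (ν : SignedMeasure X) (f : X → ℝ) :
    sigma lam φ H M f ν ∈ diffPoly lam φ M := by
  have : sigma lam φ H M f ν =
      ∑ k ∈ hX.freq M, (H (lam k / M) * ∫ᵛ y, f y * φ k y ∂•ν) • φ k := by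
    ext x
    rw [sigma, tsum_eq_sum (s := hX.freq M) fun k hk => by rw [hX.filter_eq_zero hH hM hk]; ring]
    simp
  rw [this]
  exact Submodule.sum_mem _ fun k hk => Submodule.smul_mem _ _ (phi_mem_diffPoly (hX.mem_freq.1 hk))

/-- The filtered kernel of order `M` reproduces `Π_{M / 2}`. -/
theorem IsDiffusionMeasureSpace.integral_mul_filterKernel
    (hX : IsDiffusionMeasureSpace ρ μ lam φ α) {H : ℝ → ℝ} (hH : IsLowPass H) {M : ℝ}
    (hM : 0 < M) {Q : X → ℝ} (hQ : Q ∈ diffPoly lam φ (M / 2)) (x : X) :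
    ∫ y, Q y * filterKernel lam φ H M x y ∂μ = Q x := by
  have hKm := hX.filterKernel_mem hH hM x
  have hint : ∀ Q ∈ diffPoly lam φ (M / 2),
      Integrable (fun y => Q y * filterKernel lam φ H M x y) μ := by
    intro Q hQ
    refine hX.integrable_of_mem hKm ?_
    simpa using hX.integrable_of_mem hQ (ν := μ) (integrable_const 1)
  refine Submodule.span_induction
    (p := fun Q _ => ∫ y, Q y * filterKernel lam φ H M x y ∂μ = Q x) ?_ ?_ ?_ ?_ hQ
  · rintro _ ⟨j, hj, rfl⟩
    have hj' : lam j ≤ M / 2 := hj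
    have h2 : ∀ y, φ j y * filterKernel lam φ H M x y = ∑ k ∈ hX.freq M,
        (H (lam k / M) * φ k x) * (φ j y * φ k y) := by
      intro y
      rw [hX.filterKernel_eq_sum hH hM, Finset.mul_sum]
      exact Finset.sum_congr rfl fun k _ => by ring
    simp only [h2]
    rw [integral_finsetSum _ fun k _ => (hX.integrable_phi_mul_phi j k).const_mul _]
    simp only [integral_const_mul, hX.integral_phi_mul_phi]
    rw [Finset.sum_eq_single j (fun k _ hk => by simp [hk.symm])]
    · rw [hH.eq_one _ (div_nonneg (hX.lam_nonneg j) hM.le)]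
      · simp
      · rw [div_le_iff₀ hM]; linarith
    · intro h
      refine absurd ?_ h
      rw [hX.mem_freq]; linarith
  · simp
  · intro P Q hP hQ h1 h2
    simp only [Pi.add_apply, add_mul]
    rw [integral_add (hint P hP) (hint Q hQ), h1, h2]
  · intro c P hP h1
    simp only [Pi.smul_apply, smul_eq_mul, mul_assoc]
    rw [integral_const_mul, h1]

/-- The product of `Q ∈ Π_N` and `K_M(x, ·) ∈ Π_{2N}` lies in `Π_{aN}`, so `ν` may be replaced by
`μ`. It serves with `M = N` for `σ_N` and with `M = 2N` for the reconstruction. -/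
theorem IsDiffusionMeasureSpace.signed_integral_mul_filterKernel
    (hX : IsDiffusionMeasureSpace ρ μ lam φ α) {H : ℝ → ℝ} (hH : IsLowPass H)
    {a : ℝ} (ha : StrongProduct lam φ a) {n : ℕ} {ν : SignedMeasure X}
    (hν : IsQuadrature μ lam φ a ((2 : ℝ) ^ n) ν) {M : ℝ} (hM : 0 < M) (hM2 : M ≤ 2 * 2 ^ n)
    {Q : X → ℝ} (hQ : Q ∈ diffPoly lam φ (M / 2)) (x : X) :
    ∫ᵛ y, Q y * filterKernel lam φ H M x y ∂•ν = Q x := by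
  have h1 := ha.2 n Q (diffPoly_mono (by linarith) hQ) _
    (diffPoly_mono hM2 (hX.filterKernel_mem hH hM x))
  rw [← hX.integral_mul_filterKernel hH hM hQ x]
  exact (hν _ h1).symm

theorem IsDiffusionMeasureSpace.exists_lintegral_enorm_filterKernel_le
    (hX : IsDiffusionMeasureSpace ρ μ lam φ α) {H : ℝ → ℝ} (hH : IsLowPass H) :
    ∃ C : ℝ, 0 < C ∧ ∀ M : ℝ, 1 ≤ M → ∀ x,
      ∫⁻ y, ‖filterKernel lam φ H M x y‖ₑ ∂μ ≤ ENNReal.ofReal C := by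
  obtain ⟨C, hC, h⟩ := hX.exists_lintegral_filterKernel_rpow_le hH le_rfl
  refine ⟨C, hC, fun M hM x => ?_⟩
  have := h M hM x
  simpa [Real.enorm_eq_ofReal_abs] using this

end DiffusionSpace

/-! ### Counting bits; approximation by filtered projections -/

namespace DiffusionSpace

theorem totalBits_le {X : Type*} {A : Set X} (hA : A.Finite) {I : X → ℤ} {b : ℕ}
    (hI : ∀ y, |(I y : ℝ)| < 2 ^ b) : totalBits A I ≤ A.ncard * (b + 1) := by
  rw [totalBits, finsum_mem_eq_finite_toFinset_sum _ hA, Set.ncard_eq_toFinset_card A hA,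
    ← smul_eq_mul]
  refine Finset.sum_le_card_nsmul _ _ _ fun y _ => ?_
  refine Nat.add_le_add_right (Nat.size_le.2 ?_) 1
  have := hI y
  rw [← Int.cast_abs, Int.abs_eq_natAbs] at this
  exact_mod_cast this

/-- Counting the bits of the quantized values in terms of the accuracy. -/
theorem exists_totalBits_le {X : Type*} {α s S c D E : ℝ} (hs : 0 < s) (hc : 0 < c)
    (hD : 0 ≤ D) :
    ∃ C : ℝ, 0 < C ∧ ∀ (n : ℕ) (r : ℝ), 0 < r → ∀ (A : Set X) (P : X → ℝ),
      A.Finite → (A.ncard : ℝ) ≤ E * ((2 : ℝ) ^ n) ^ α →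
      (∀ y, |P y| ≤ D * r * ((2 : ℝ) ^ n) ^ α) →
      ∀ ε : ℝ, ε = c * r * ((2 : ℝ) ^ n) ^ (-s) → ε ≤ 1 → ε ≤ r →
        (totalBits A (fun y => ⌊((2 : ℝ) ^ n) ^ S * P y⌋) : ℝ) ≤
          C * (r / ε) ^ (α / s) * (1 + Real.logb 2 (r / ε)) := by
  obtain ⟨b, hb⟩ := exists_nat_ge (S + α + s)
  obtain ⟨d, hd⟩ := pow_unbounded_of_one_lt (D / c + 1) (one_lt_two : (1 : ℝ) < 2)
  -- Chosen so that `n ≤ L (1 + log₂ (r / ε))`, because `log₂ (r / ε) = s n - log₂ c`.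
  set L := (1 + |Real.logb 2 c|) / s with hL
  have hL0 : 0 < L := by positivity
  refine ⟨(|E| + 1) * c ^ (α / s) * (d + 1 + b * L), by positivity, ?_⟩
  intro n r hr A P hA hcard hP ε hε hε1 hεr
  set N : ℝ := 2 ^ n with hN
  have hN1 : 1 ≤ N := one_le_pow₀ (by norm_num)
  have hN0 : 0 < N := by linarith
  have hε0 : 0 < ε := by rw [hε]; positivity
  have hNs : 0 < N ^ s := by positivity
  have hR : r / ε = N ^ s / c := by
    rw [hε, Real.rpow_neg hN0.le]; field_simp
  have hR1 : 1 ≤ r / ε := (one_le_div hε0).2 hεr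
  have hlog0 : 0 ≤ Real.logb 2 (r / ε) := Real.logb_nonneg (by norm_num) hR1
  have hlog : Real.logb 2 (r / ε) = s * n - Real.logb 2 c := by
    rw [hR, Real.logb_div hNs.ne' hc.ne', Real.logb_rpow_eq_mul_logb_of_pos hN0, hN,
      Real.logb_pow]
    simp
  have hRα : (r / ε) ^ (α / s) * c ^ (α / s) = N ^ α := by
    rw [hR, ← Real.mul_rpow (by positivity) hc.le, div_mul_cancel₀ _ hc.ne', ← Real.rpow_mul hN0.le,
      mul_div_cancel₀ _ hs.ne']
  -- Here `ε ≤ 1` is used: it removes `r` from the size of the integers, leaving a power of `N`.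
  have hcr : r ≤ N ^ s / c := by
    rw [le_div_iff₀ hc]
    rw [hε, Real.rpow_neg hN0.le, ← div_eq_mul_inv, div_le_one hNs] at hε1
    linarith
  have hI : ∀ y, |((⌊N ^ S * P y⌋ : ℤ) : ℝ)| < 2 ^ (d + b * n) := by
    intro y
    have h1 : |((⌊N ^ S * P y⌋ : ℤ) : ℝ)| ≤ |N ^ S * P y| + 1 := by
      have h2 := Int.floor_le (N ^ S * P y)
      have h3 := Int.lt_floor_add_one (N ^ S * P y)
      have h4 := neg_abs_le (N ^ S * P y)
      have h5 := le_abs_self (N ^ S * P y)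
      rw [abs_le]; constructor <;> linarith
    have hb' : N ^ S * N ^ s * N ^ α ≤ N ^ b := by
      rw [← Real.rpow_add hN0, ← Real.rpow_add hN0, ← Real.rpow_natCast]
      exact Real.rpow_le_rpow_of_exponent_le hN1 (by linarith)
    have hb1 : (1 : ℝ) ≤ N ^ b := one_le_pow₀ hN1
    calc |((⌊N ^ S * P y⌋ : ℤ) : ℝ)| ≤ N ^ S * |P y| + 1 := by
          rwa [abs_mul, abs_of_pos (by positivity : 0 < N ^ S)] at h1
      _ ≤ N ^ S * (D * (N ^ s / c) * N ^ α) + 1 := by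
          gcongr
          exact (hP y).trans (by gcongr)
      _ = D / c * (N ^ S * N ^ s * N ^ α) + 1 := by ring
      _ ≤ D / c * N ^ b + 1 * N ^ b := by gcongr; linarith
      _ = (D / c + 1) * N ^ b := by ring
      _ < 2 ^ d * N ^ b := by gcongr
      _ = 2 ^ (d + b * n) := by rw [hN, ← pow_mul, ← pow_add, mul_comm n b]
  have hbits : (totalBits A (fun y => ⌊N ^ S * P y⌋) : ℝ) ≤ A.ncard * (d + b * n + 1) := by
    exact_mod_cast totalBits_le hA hI
  have hn : (n : ℝ) ≤ L * (1 + Real.logb 2 (r / ε)) := by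
    have h1 := le_abs_self (Real.logb 2 c)
    have h2 := abs_nonneg (Real.logb 2 c)
    rw [hL, div_mul_eq_mul_div, le_div_iff₀ hs]
    nlinarith
  have h1 : (d : ℝ) + b * n + 1 ≤ (d + 1 + b * L) * (1 + Real.logb 2 (r / ε)) := by
    have hb0 : (0 : ℝ) ≤ b := Nat.cast_nonneg b
    have hd0 : (0 : ℝ) ≤ d := Nat.cast_nonneg d
    have := mul_le_mul_of_nonneg_left hn hb0
    nlinarith
  calc _ ≤ (A.ncard : ℝ) * (d + b * n + 1) := hbits
    _ ≤ ((|E| + 1) * N ^ α) * ((d + 1 + b * L) * (1 + Real.logb 2 (r / ε))) := by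
        gcongr
        refine hcard.trans ?_
        gcongr
        linarith [le_abs_self E]
    _ = _ := by rw [← hRα]; ring

theorem lintegral_enorm_mul_le {X : Type*} [MeasurableSpace X] {ν : Measure X} {h K : X → ℝ} {A C : ℝ≥0∞} (hA : A ≠ ∞)
    (hh : ∀ y, ‖h y‖ₑ ≤ A) (hK : ∫⁻ y, ‖K y‖ₑ ∂ν ≤ C) : ∫⁻ y, ‖h y * K y‖ₑ ∂ν ≤ A * C :=
  calc _ ≤ ∫⁻ y, A * ‖K y‖ₑ ∂ν := lintegral_mono fun y => by rw [enorm_mul]; gcongr; exact hh y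
    _ = A * ∫⁻ y, ‖K y‖ₑ ∂ν := lintegral_const_mul' _ _ hA
    _ ≤ _ := by gcongr

/-- The approximant comes from `Π_{N/2}` because that is the space which `σ_N` reproduces. For `N =
1` the order `1/2` is not among those in the norm, and `0` serves, with error at most `B r`. The
extra `2` beside `2 ^ s` allows for an infimum that is not attained. -/
theorem exists_near_best_approx {X : Type*} [TopologicalSpace X] [MeasurableSpace X]
    {μ : Measure X} {lam : ℕ → ℝ} {φ : ℕ → X → ℝ} {p : ℝ≥0∞} {s B r : ℝ} (hB : 0 < B) (hr : 0 < r)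
    {f ψ : X → ℝ} (hψ : ∀ x, |ψ x| ≤ B) (hf : f ∈ cutoffSobolevBall μ lam φ p s ψ r) (n : ℕ) :
    ∃ P ∈ diffPoly lam φ ((2 : ℝ) ^ n / 2),
      eLpNorm (f * ψ - P) p μ ≤ ENNReal.ofReal ((2 * 2 ^ s + B) * r * ((2 : ℝ) ^ n) ^ (-s)) := by
  have hnorm := hf.2
  unfold cutoffSobolevNorm at hnorm
  rcases n with _ | k
  · refine ⟨0, Submodule.zero_mem _, ?_⟩
    have h1 : eLpNorm (f * ψ) p μ ≤ ENNReal.ofReal B * eLpNorm f p μ := by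
      refine eLpNorm_le_mul_eLpNorm_of_ae_le_mul (Eventually.of_forall fun x => ?_) p
      rw [Pi.mul_apply, norm_mul, mul_comm]
      gcongr
      exact hψ x
    rw [sub_zero]
    refine h1.trans ((mul_le_mul_right (le_self_add.trans hnorm) _).trans ?_)
    rw [← ENNReal.ofReal_mul hB.le]
    refine ENNReal.ofReal_le_ofReal ?_
    rw [pow_zero, Real.one_rpow, mul_one]
    have : (0 : ℝ) < 2 * 2 ^ s := by positivity
    gcongr
    linarith
  · have h1 : ENNReal.ofReal (((2 : ℝ) ^ k) ^ s) * bestError μ lam φ p (f * ψ) ((2 : ℝ) ^ k) ≤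
        ENNReal.ofReal r := by
      refine le_trans ?_ (le_add_self.trans hnorm)
      exact le_iSup (fun n : ℕ => ENNReal.ofReal (((2 : ℝ) ^ n) ^ s) *
        bestError μ lam φ p (f * ψ) ((2 : ℝ) ^ n)) k
    have hk0 : (0 : ℝ) < ((2 : ℝ) ^ k) ^ s := by positivity
    have h2 : bestError μ lam φ p (f * ψ) ((2 : ℝ) ^ k) <
        ENNReal.ofReal (2 * r / ((2 : ℝ) ^ k) ^ s) := by
      refine lt_of_le_of_lt (b := ENNReal.ofReal (r / ((2 : ℝ) ^ k) ^ s)) ?_ ?_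
      · rw [ENNReal.ofReal_div_of_pos hk0, ENNReal.le_div_iff_mul_le
          (Or.inl (by simpa using hk0)) (Or.inl ENNReal.ofReal_ne_top), mul_comm]
        exact h1
      · rw [ENNReal.ofReal_lt_ofReal_iff (by positivity)]
        gcongr
        linarith
    obtain ⟨P, hP⟩ := iInf_lt_iff.1 h2
    obtain ⟨hPm, hP⟩ := iInf_lt_iff.1 hP
    refine ⟨P, by rwa [pow_succ, mul_div_cancel_right₀ _ (two_ne_zero' ℝ)], hP.le.trans ?_⟩
    refine ENNReal.ofReal_le_ofReal ?_
    rw [pow_succ, Real.mul_rpow (by positivity) (by norm_num), Real.rpow_neg (by positivity),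
      Real.rpow_neg (by norm_num : (0 : ℝ) ≤ 2)]
    have h2s : (0 : ℝ) < 2 ^ s := by positivity
    calc 2 * r / ((2 : ℝ) ^ k) ^ s = (2 * 2 ^ s) * r * ((((2 : ℝ) ^ k) ^ s)⁻¹ * (2 ^ s)⁻¹) := by
          field_simp
      _ ≤ _ := by gcongr; linarith

variable {X : Type*} {ρ : X → X → ℝ} {lam : ℕ → ℝ} {φ : ℕ → X → ℝ} {α : ℝ}
  [TopologicalSpace X] [MeasurableSpace X] [BorelSpace X]
  {μ : Measure X} [IsProbabilityMeasure μ]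

theorem IsDiffusionMeasureSpace.memLp_of_mem (hX : IsDiffusionMeasureSpace ρ μ lam φ α) {M : ℝ}
    {P : X → ℝ} (hP : P ∈ diffPoly lam φ M) (p : ℝ≥0∞) : MemLp P p μ := by
  obtain ⟨B, hB⟩ := hX.exists_abs_le_of_mem hP
  exact MemLp.of_bound (hX.continuous_of_mem hP).measurable.aestronglyMeasurable B
    (Eventually.of_forall hB)

/-- Far from the diagonal the kernels are negligible. -/
theorem IsDiffusionMeasureSpace.exists_abs_filterKernel_le_of_le
    (hX : IsDiffusionMeasureSpace ρ μ lam φ α) {H : ℝ → ℝ} (hH : IsLowPass H) {δ : ℝ}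
    (hδ : 0 < δ) (τ : ℝ) :
    ∃ C : ℝ, 0 < C ∧ ∀ M : ℝ, 1 ≤ M → ∀ x y, δ ≤ ρ x y →
      |filterKernel lam φ H M x y| ≤ C * M ^ (-τ) := by
  obtain ⟨m, hm⟩ := exists_nat_ge (α + τ)
  obtain ⟨C, hC, hK⟩ := hX.exists_abs_filterKernel_le hH m
  have hδ1 : 0 < min δ 1 := lt_min hδ one_pos
  refine ⟨C * (min δ 1 ^ m)⁻¹, by positivity, fun M hM x y hxy => (hK M hM x y).trans ?_⟩
  have hM0 : 0 < M := by linarith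
  have h1 : decayWeight ρ m M x y ≤ (min δ 1 ^ m)⁻¹ * (M ^ m)⁻¹ := by
    rw [decayWeight, ← mul_inv, ← mul_pow]
    have : min δ 1 ≤ min (ρ x y) 1 := min_le_min_right 1 hxy
    gcongr
    nlinarith
  have h2 : M ^ α * (M ^ m)⁻¹ ≤ M ^ (-τ) := by
    rw [← Real.rpow_natCast, ← Real.rpow_neg hM0.le, ← Real.rpow_add hM0]
    exact Real.rpow_le_rpow_of_exponent_le hM (by linarith)
  calc C * M ^ α * decayWeight ρ m M x y ≤ C * M ^ α * ((min δ 1 ^ m)⁻¹ * (M ^ m)⁻¹) := by gcongr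
    _ = C * (min δ 1 ^ m)⁻¹ * (M ^ α * (M ^ m)⁻¹) := by ring
    _ ≤ _ := by gcongr

/-- The filtered projections are uniformly bounded on `L_p`, and satisfy a Nikolskii inequality. -/
theorem IsDiffusionMeasureSpace.exists_sigma_le
    (hX : IsDiffusionMeasureSpace ρ μ lam φ α) {H : ℝ → ℝ} (hH : IsLowPass H)
    {a : ℝ} (ha : StrongProduct lam φ a) {p : ℝ≥0∞} (hp : 1 ≤ p)
    {μs : ℕ → SignedMeasure X}
    (hμs_top : p = ∞ → IsUniformMZQuadrature μ lam φ a p μs)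
    (hμs : p ≠ ∞ → ∀ n, μs n = μ.toSignedMeasure) :
    ∃ C : ℝ, 0 < C ∧ ∀ n, IsQuadrature μ lam φ a ((2 : ℝ) ^ n) (μs n) ∧
      ∀ h : X → ℝ, MemLp h p μ → (p = ∞ → Continuous h) →
        Integrable h (μs n).totalVariation ∧
        eLpNorm (sigma lam φ H ((2 : ℝ) ^ n) h (μs n)) p μ ≤ ENNReal.ofReal C * eLpNorm h p μ ∧
        ∀ x, ‖sigma lam φ H ((2 : ℝ) ^ n) h (μs n) x‖ₑ ≤
          ENNReal.ofReal (C * ((2 : ℝ) ^ n) ^ α) * eLpNorm h p μ := by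
  have hα := hX.alpha_pos
  -- For `p = ∞` the row bounds of the measures `μ_N` suffice, and continuity makes the essential
  -- bound of `h` valid on their supports. For `p < ∞` the measure is `μ`, and Schur's test applies.
  by_cases hp' : p = ∞
  · subst hp'
    have hMZ := hμs_top rfl
    obtain ⟨C, hC, hb⟩ := hMZ.exists_lintegral_kernel_le hX hH ha hp
    have := hX.isOpenPosMeasure hH
    refine ⟨C, hC, fun n => ⟨hMZ.1 n, fun h hh hc => ?_⟩⟩
    have hN1 : (1 : ℝ) ≤ 2 ^ n := one_le_pow₀ (by norm_num)
    have hN0 : (0 : ℝ) < 2 ^ n := by positivity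
    have hbd := enorm_le_eLpNorm_top (μ := μ) (hc rfl)
    have hfin : eLpNorm h ∞ μ ≠ ∞ := hh.2.ne
    have hint : Integrable h (μs n).totalVariation := by
      refine Integrable.of_bound (hc rfl).measurable.aestronglyMeasurable
        (eLpNorm h ∞ μ).toReal (Eventually.of_forall fun y => ?_)
      rw [← toReal_enorm]
      exact ENNReal.toReal_mono hfin (hbd y)
    have hpt : ∀ x, ‖sigma lam φ H ((2 : ℝ) ^ n) h (μs n) x‖ₑ ≤
        ENNReal.ofReal C * eLpNorm h ∞ μ := by
      intro x
      rw [hX.sigma_eq_integral hH hN0 hint, mul_comm]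
      exact (enorm_signed_integral_le _ _).trans
        (lintegral_enorm_mul_le hfin hbd ((hb n).2.1 x))
    refine ⟨hint, ?_, fun x => (hpt x).trans ?_⟩
    · rw [eLpNorm_exponent_top]
      exact eLpNormEssSup_le_of_ae_enorm_bound (Eventually.of_forall hpt)
    · gcongr
      have := Real.one_le_rpow hN1 hα.le
      nlinarith
  · obtain ⟨C₁, hC₁, hrow⟩ := hX.exists_lintegral_enorm_filterKernel_le hH
    -- With `m = 0` the weight is `1`: only the size `M^α` of the kernel matters for the pointwise
    -- bound.
    obtain ⟨C₂, hC₂, hK⟩ := hX.exists_abs_filterKernel_le hH 0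
    have hμn := hμs hp'
    refine ⟨max C₁ C₂, by positivity, fun n => ?_⟩
    rw [hμn n]
    have hvar : (μ.toSignedMeasure).totalVariation = μ := by
      rw [SignedMeasure.totalVariation_eq_variation, Measure.variation_toSignedMeasure]
    refine ⟨fun P _ => (signed_integral_toSignedMeasure μ P).symm, fun h hh _ => ?_⟩
    have hN1 : (1 : ℝ) ≤ 2 ^ n := one_le_pow₀ (by norm_num)
    have hN0 : (0 : ℝ) < 2 ^ n := by positivity
    have hint : Integrable h (μ.toSignedMeasure).totalVariation := by
      rw [hvar]; exact hh.integrable hp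
    have hpt : ∀ x, ‖sigma lam φ H ((2 : ℝ) ^ n) h μ.toSignedMeasure x‖ₑ ≤
        ∫⁻ y, ‖h y * filterKernel lam φ H ((2 : ℝ) ^ n) x y‖ₑ ∂μ := by
      intro x
      rw [hX.sigma_eq_integral hH hN0 hint]
      refine (enorm_signed_integral_le _ _).trans (le_of_eq ?_)
      rw [hvar]
    refine ⟨hint, ?_, fun x => (hpt x).trans ?_⟩
    · have hcol : ∀ y, ∫⁻ x, ‖filterKernel lam φ H ((2 : ℝ) ^ n) x y‖ₑ ∂μ ≤
          ENNReal.ofReal C₁ := by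
        intro y
        simp only [filterKernel_symm H _ _ y]
        exact hrow _ hN1 y
      refine (eLpNorm_le_of_enorm_le_lintegral_kernel hp hp' (hX.measurable_filterKernel hH hN0)
        (by simpa using hC₁) ENNReal.ofReal_ne_top (hrow _ hN1) hcol hh.1 hpt).trans ?_
      gcongr
      exact le_max_left _ _
    · have hK' : ∀ y, ‖filterKernel lam φ H ((2 : ℝ) ^ n) x y‖ₑ ≤
          ENNReal.ofReal (C₂ * ((2 : ℝ) ^ n) ^ α) := by
        intro y
        rw [Real.enorm_eq_ofReal_abs]
        refine ENNReal.ofReal_le_ofReal ((hK _ hN1 x y).trans (le_of_eq ?_))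
        simp [decayWeight]
      have h1 : ∫⁻ y, ‖h y‖ₑ ∂μ ≤ eLpNorm h p μ := by
        rw [← eLpNorm_one_eq_lintegral_enorm]
        exact eLpNorm_le_eLpNorm_of_exponent_le hp hh.1
      simp only [mul_comm (h _)]
      refine (lintegral_enorm_mul_le ENNReal.ofReal_ne_top hK' h1).trans ?_
      gcongr
      exact le_max_right _ _

theorem IsDiffusionMeasureSpace.exists_abs_le_of_mem_smoothFunctions
    (hX : IsDiffusionMeasureSpace ρ μ lam φ α) {H : ℝ → ℝ} (hH : IsLowPass H) {ψ : X → ℝ}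
    (hψ : ψ ∈ smoothFunctions μ lam φ) : ∃ B : ℝ, 0 < B ∧ ∀ x, |ψ x| ≤ B := by
  have := hX.isOpenPosMeasure hH
  have h1 := hψ.2 1 one_pos
  have hfin : eLpNorm ψ ∞ μ < ∞ := lt_of_le_of_lt le_self_add h1
  refine ⟨(eLpNorm ψ ∞ μ).toReal + 1, by positivity, fun x => ?_⟩
  have := ENNReal.toReal_mono hfin.ne (enorm_le_eLpNorm_top (μ := μ) hψ.1 x)
  rw [toReal_enorm, Real.norm_eq_abs] at this
  linarith

/-- The approximation of the localized function by filtered projections. -/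
theorem IsDiffusionMeasureSpace.exists_approx
    (hX : IsDiffusionMeasureSpace ρ μ lam φ α) {H : ℝ → ℝ} (hH : IsLowPass H)
    {a : ℝ} (ha : StrongProduct lam φ a) {p : ℝ≥0∞} (hp : 1 ≤ p)
    {μs : ℕ → SignedMeasure X}
    (hμs_top : p = ∞ → IsUniformMZQuadrature μ lam φ a p μs)
    (hμs : p ≠ ∞ → ∀ n, μs n = μ.toSignedMeasure)
    {ψ : X → ℝ} (hψ : ψ ∈ smoothFunctions μ lam φ) (s : ℝ) :
    ∃ C : ℝ, 0 < C ∧ ∀ (n : ℕ) (r : ℝ), 0 < r → ∀ f ∈ cutoffSobolevBall μ lam φ p s ψ r,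
      AEStronglyMeasurable (f * ψ) μ ∧
      eLpNorm (f * ψ - sigma lam φ H ((2 : ℝ) ^ n) (f * ψ) (μs n)) p μ ≤
        ENNReal.ofReal (C * r * ((2 : ℝ) ^ n) ^ (-s)) ∧
      ∀ x, |sigma lam φ H ((2 : ℝ) ^ n) (f * ψ) (μs n) x| ≤ C * r * ((2 : ℝ) ^ n) ^ α := by
  obtain ⟨B, hB, hψB⟩ := hX.exists_abs_le_of_mem_smoothFunctions hH hψ
  obtain ⟨C, hC, hσ⟩ := hX.exists_sigma_le hH ha hp hμs_top hμs
  refine ⟨max ((1 + C) * (2 * 2 ^ s + B)) (C * B), by positivity, fun n r hr f hf => ?_⟩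
  have hN0 : (0 : ℝ) < 2 ^ n := by positivity
  have hψm : AEStronglyMeasurable ψ μ := hψ.1.measurable.aestronglyMeasurable
  have hgc : p = ∞ → Continuous (f * ψ) := fun h => (hf.1.2.1 h).mul hψ.1
  have hgn : eLpNorm (f * ψ) p μ ≤ ENNReal.ofReal (B * r) := by
    have h1 : eLpNorm (f * ψ) p μ ≤ ENNReal.ofReal B * eLpNorm f p μ := by
      refine eLpNorm_le_mul_eLpNorm_of_ae_le_mul (Eventually.of_forall fun x => ?_) p
      rw [Pi.mul_apply, norm_mul, mul_comm]
      gcongr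
      exact hψB x
    refine h1.trans ?_
    rw [ENNReal.ofReal_mul hB.le]
    exact mul_le_mul_right (le_self_add.trans hf.2) _
  have hg : MemLp (f * ψ) p μ := ⟨hf.1.1.1.mul hψm, hgn.trans_lt ENNReal.ofReal_lt_top⟩
  obtain ⟨P, hP, hgP⟩ := exists_near_best_approx hB hr hψB hf n
  obtain ⟨hquad, hσn⟩ := hσ n
  obtain ⟨hgi, -, hgsup⟩ := hσn _ hg hgc
  have hPL := hX.memLp_of_mem hP p
  obtain ⟨hPi, -, -⟩ := hσn P hPL fun _ => hX.continuous_of_mem hP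
  obtain ⟨hdi, hdL, -⟩ := hσn (f * ψ - P) (hg.sub hPL)
    fun h => (hgc h).sub (hX.continuous_of_mem hP)
  -- Since `σ_N P = P`, the error of `fψ` equals the error of `fψ - P`, and boundedness of `σ_N`
  -- finishes the estimate.
  have hsub : f * ψ - sigma lam φ H ((2 : ℝ) ^ n) (f * ψ) (μs n) =
      (f * ψ - P) - sigma lam φ H ((2 : ℝ) ^ n) (f * ψ - P) (μs n) := by
    ext x
    have h1 : sigma lam φ H ((2 : ℝ) ^ n) (f * ψ - P) (μs n) x =
        sigma lam φ H ((2 : ℝ) ^ n) (f * ψ) (μs n) x - P x := by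
      have hKm := hX.filterKernel_mem hH hN0 x
      rw [hX.sigma_eq_integral hH hN0 hdi, hX.sigma_eq_integral hH hN0 hgi,
        ← hX.signed_integral_mul_filterKernel hH ha hquad hN0 (by linarith) hP x,
        ← signed_integral_sub _ (hX.integrable_of_mem hKm hgi) (hX.integrable_of_mem hKm hPi)]
      simp only [Pi.sub_apply, sub_mul]
    simp only [Pi.sub_apply, h1]
    ring
  refine ⟨hg.1, ?_, fun x => ?_⟩
  · rw [hsub]
    refine (eLpNorm_sub_le (hg.sub hPL).1 (hX.continuous_of_mem
      (hX.sigma_mem hH hN0 _ _)).measurable.aestronglyMeasurable hp).trans ?_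
    calc _ ≤ eLpNorm (f * ψ - P) p μ + ENNReal.ofReal C * eLpNorm (f * ψ - P) p μ := by gcongr
      _ = ENNReal.ofReal (1 + C) * eLpNorm (f * ψ - P) p μ := by
          rw [ENNReal.ofReal_add zero_le_one hC.le, ENNReal.ofReal_one, add_mul, one_mul]
      _ ≤ ENNReal.ofReal (1 + C) * ENNReal.ofReal ((2 * 2 ^ s + B) * r * ((2 : ℝ) ^ n) ^ (-s)) := by
          gcongr
      _ ≤ _ := by
          rw [← ENNReal.ofReal_mul (by positivity)]
          refine ENNReal.ofReal_le_ofReal ?_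
          rw [← mul_assoc, ← mul_assoc]
          gcongr
          exact le_max_left _ _
  · have h1 := (hgsup x).trans (mul_le_mul_right hgn _)
    rw [← ENNReal.ofReal_mul (by positivity), Real.enorm_eq_ofReal_abs,
      ENNReal.ofReal_le_ofReal_iff (by positivity)] at h1
    refine h1.trans ?_
    calc C * ((2 : ℝ) ^ n) ^ α * (B * r) = C * B * r * ((2 : ℝ) ^ n) ^ α := by ring
      _ ≤ _ := by gcongr; exact le_max_right _ _

end DiffusionSpace

/-! ### Error of the quantized reconstruction -/

namespace DiffusionSpace

/-- Mass at most `1` bounds the norm of the constant by `D`. It is meant for `ν = μ` and for the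
restriction of `μ` to `B'`. -/
theorem eLpNorm_sub_le_of_abs_le {X : Type*} [MeasurableSpace X] {μ ν : Measure X}
    [IsProbabilityMeasure μ] (hν : ν ≤ μ) {p : ℝ≥0∞} (hp : 1 ≤ p) {u F T : X → ℝ} {A D : ℝ}
    (hA : 0 ≤ A) (hD : 0 ≤ D) (hu : AEStronglyMeasurable u μ)
    (huA : eLpNorm u p μ ≤ ENNReal.ofReal A) (h : ∀ᵐ x ∂ν, |F x - T x| ≤ |u x| + D) :
    eLpNorm (F - T) p ν ≤ ENNReal.ofReal (A + D) := by
  have hun : AEStronglyMeasurable (fun x => ‖u x‖) ν := (hu.mono_measure hν).norm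
  have hν1 : ν univ ≤ 1 := (hν univ).trans_eq measure_univ
  calc eLpNorm (F - T) p ν ≤ eLpNorm ((fun x => ‖u x‖) + fun _ => D) p ν := by
        refine eLpNorm_mono_ae ?_
        filter_upwards [h] with x hx
        refine hx.trans (le_abs_self _)
    _ ≤ eLpNorm (fun x => ‖u x‖) p ν + eLpNorm (fun _ => D) p ν :=
        eLpNorm_add_le hun aestronglyMeasurable_const hp
    _ ≤ ENNReal.ofReal A + ENNReal.ofReal D := by
        gcongr
        · rw [eLpNorm_norm]
          exact (eLpNorm_mono_measure _ hν).trans huA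
        · refine (eLpNorm_le_of_ae_bound (C := D) (Eventually.of_forall fun x => ?_)).trans ?_
          · rw [Real.norm_eq_abs, abs_of_nonneg hD]
          · exact mul_le_of_le_one_left zero_le
              (ENNReal.rpow_le_one hν1 (by positivity))
    _ = _ := (ENNReal.ofReal_add hA hD).symm

theorem abs_sub_rpow_neg_mul_floor_le {N : ℝ} (hN : 0 < N) (S v : ℝ) :
    |v - N ^ (-S) * (⌊N ^ S * v⌋ : ℤ)| ≤ N ^ (-S) := by
  have hS : 0 < N ^ S := by positivity
  have h1 : v - N ^ (-S) * (⌊N ^ S * v⌋ : ℤ) = N ^ (-S) * Int.fract (N ^ S * v) := by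
    rw [Int.fract, mul_sub, ← mul_assoc, Real.rpow_neg hN.le, inv_mul_cancel₀ hS.ne', one_mul]
  rw [h1, abs_mul, abs_of_nonneg (Int.fract_nonneg (N ^ S * v)), abs_of_pos (by positivity)]
  exact mul_le_of_le_one_right (by positivity) (Int.fract_lt_one _).le

variable {X : Type*} {ρ : X → X → ℝ} {lam : ℕ → ℝ} {φ : ℕ → X → ℝ} {α : ℝ}
  [TopologicalSpace X] [MeasurableSpace X] [BorelSpace X]
  {μ : Measure X} [IsProbabilityMeasure μ]

/-- The error of the reconstruction from quantized values, globally and locally. -/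
theorem IsDiffusionMeasureSpace.exists_quantization_error_le
    (hX : IsDiffusionMeasureSpace ρ μ lam φ α) {H : ℝ → ℝ} (hH : IsLowPass H)
    {a : ℝ} (ha : StrongProduct lam φ a) {p : ℝ≥0∞} (hp : 1 ≤ p)
    {νs : ℕ → SignedMeasure X} (hνs : IsUniformMZQuadrature μ lam φ a p νs) {δ : ℝ} (hδ : 0 < δ)
    (τ : ℝ) :
    ∃ C : ℝ, 0 < C ∧ ∀ (n : ℕ) (S D : ℝ) (B : Set X), 0 < S → 0 ≤ D → MeasurableSet B →
      ∀ P ∈ diffPoly lam φ ((2 : ℝ) ^ n), (∀ y, |P y| ≤ D) →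
      (∀ x, |P x - ((2 : ℝ) ^ n) ^ (-S) * ∫ᵛ y, ((⌊((2 : ℝ) ^ n) ^ S * P y⌋ : ℤ) : ℝ) *
        filterKernel lam φ H (2 * (2 : ℝ) ^ n) x y ∂•(νs n)| ≤ C * ((2 : ℝ) ^ n) ^ (-S)) ∧
      ∀ x, (∀ y ∉ B, δ ≤ ρ x y) →
        |P x - ((2 : ℝ) ^ n) ^ (-S) * ∫ᵛ y in B, ((⌊((2 : ℝ) ^ n) ^ S * P y⌋ : ℤ) : ℝ) *
        filterKernel lam φ H (2 * (2 : ℝ) ^ n) x y ∂•(νs n)| ≤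
          C * ((2 : ℝ) ^ n) ^ (-S) + C * (D + 1) * (2 * (2 : ℝ) ^ n) ^ (-τ) := by
  obtain ⟨C₁, hC₁, hb⟩ := hνs.exists_lintegral_kernel_le hX hH ha hp
  obtain ⟨C₂, hC₂, hfar⟩ := hX.exists_abs_filterKernel_le_of_le hH hδ τ
  refine ⟨max C₁ (C₂ * C₁), by positivity, fun n S D B hS hD hB P hP hPD => ?_⟩
  obtain ⟨hmass, -, hrow⟩ := hb n
  set N : ℝ := 2 ^ n with hN
  have hN1 : 1 ≤ N := one_le_pow₀ (by norm_num)
  have hN0 : 0 < N := by linarith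
  have hNS : 0 < N ^ (-S) := by positivity
  have hNS1 : N ^ (-S) ≤ 1 := Real.rpow_le_one_of_one_le_of_nonpos hN1 (by linarith)
  set ν := νs n with hν
  set J : X → ℝ := fun y => N ^ (-S) * (⌊N ^ S * P y⌋ : ℤ) with hJ
  have hPm : Measurable P := (hX.continuous_of_mem hP).measurable
  have hJm : Measurable J := by
    have : Measurable fun y => ⌊N ^ S * P y⌋ := Int.measurable_floor.comp (hPm.const_mul _)
    exact ((measurable_from_top (f := fun k : ℤ => (k : ℝ))).comp this).const_mul _
  have hPJ : ∀ y, |P y - J y| ≤ N ^ (-S) := fun y => abs_sub_rpow_neg_mul_floor_le hN0 S (P y)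
  have hJb : ∀ y, |J y| ≤ D + 1 := by
    intro y
    have h1 := abs_sub_abs_le_abs_sub (J y) (P y)
    rw [abs_sub_comm] at h1
    linarith [hPJ y, hPD y]
  have hPi : Integrable P ν.totalVariation :=
    Integrable.of_bound hPm.aestronglyMeasurable D (Eventually.of_forall hPD)
  have hJi : Integrable J ν.totalVariation :=
    Integrable.of_bound hJm.aestronglyMeasurable (D + 1) (Eventually.of_forall hJb)
  have hKm := fun x => hX.filterKernel_mem hH (by positivity : 0 < 2 * N) x
  have hJK := fun x => hX.integrable_of_mem (hKm x) hJi
  have hPK := fun x => hX.integrable_of_mem (hKm x) hPi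
  -- Exact recovery of `P` from unrounded samples; after this only the rounding error is integrated
  -- against the kernel.
  have hrec : ∀ x, ∫ᵛ y, P y * filterKernel lam φ H (2 * N) x y ∂•ν = P x := fun x =>
    hX.signed_integral_mul_filterKernel hH ha (hνs.1 n) (by positivity) le_rfl
      (by rwa [mul_div_cancel_left₀ _ (two_ne_zero' ℝ)]) x
  have hcirc : ∀ (ν' : SignedMeasure X) x,
      N ^ (-S) * ∫ᵛ y, ((⌊N ^ S * P y⌋ : ℤ) : ℝ) * filterKernel lam φ H (2 * N) x y ∂•ν' =
        ∫ᵛ y, J y * filterKernel lam φ H (2 * N) x y ∂•ν' := by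
    intro ν' x
    rw [← signed_integral_const_mul]
    simp only [hJ, mul_assoc]
  have hglob : ∀ x, |P x - ∫ᵛ y, J y * filterKernel lam φ H (2 * N) x y ∂•ν| ≤
      C₁ * N ^ (-S) := by
    intro x
    have h1 : P x - ∫ᵛ y, J y * filterKernel lam φ H (2 * N) x y ∂•ν =
        ∫ᵛ y, (P y - J y) * filterKernel lam φ H (2 * N) x y ∂•ν := by
      conv_lhs => rw [← hrec x]
      rw [← signed_integral_sub _ (hPK x) (hJK x)]
      simp only [sub_mul]
    have h2 : ‖∫ᵛ y, (P y - J y) * filterKernel lam φ H (2 * N) x y ∂•ν‖ₑ ≤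
        ENNReal.ofReal (N ^ (-S)) * ENNReal.ofReal C₁ := by
      refine (enorm_signed_integral_le _ _).trans
        (lintegral_enorm_mul_le ENNReal.ofReal_ne_top (fun y => ?_) (hrow x))
      rw [Real.enorm_eq_ofReal_abs]
      exact ENNReal.ofReal_le_ofReal (hPJ y)
    rw [← ENNReal.ofReal_mul hNS.le, Real.enorm_eq_ofReal_abs,
      ENNReal.ofReal_le_ofReal_iff (by positivity)] at h2
    rw [h1]; linarith
  refine ⟨fun x => ?_, fun x hx => ?_⟩
  · rw [hcirc]
    refine (hglob x).trans ?_
    gcongr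
    exact le_max_left _ _
  · rw [hcirc]
    -- The omitted nodes are at distance at least `δ` from `x`, so their share is at most the mass
    -- of `|ν|` times the off-diagonal kernel bound and the size `D + 1` of the rounded values.
    have h1 := enorm_signed_setIntegral_compl_le ν hB (hJK x)
    have h2 : ∫⁻ y in Bᶜ, ‖J y * filterKernel lam φ H (2 * N) x y‖ₑ ∂ν.totalVariation ≤
        ENNReal.ofReal ((D + 1) * (C₂ * (2 * N) ^ (-τ))) * ENNReal.ofReal C₁ := by
      calc _ ≤ ∫⁻ y in Bᶜ, ENNReal.ofReal ((D + 1) * (C₂ * (2 * N) ^ (-τ)))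
            ∂ν.totalVariation := by
            refine setLIntegral_mono' hB.compl fun y hy => ?_
            rw [Real.enorm_eq_ofReal_abs, abs_mul]
            refine ENNReal.ofReal_le_ofReal ?_
            gcongr
            · exact hJb y
            · exact hfar _ (by linarith) x y (hx y hy)
        _ = ENNReal.ofReal ((D + 1) * (C₂ * (2 * N) ^ (-τ))) * ν.totalVariation Bᶜ :=
            setLIntegral_const _ _
        _ ≤ _ := by
            gcongr
            exact (measure_mono (subset_univ _)).trans hmass
    have h3 := h1.trans h2
    rw [← ENNReal.ofReal_mul (by positivity), Real.enorm_eq_ofReal_abs,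
      ENNReal.ofReal_le_ofReal_iff (by positivity)] at h3
    calc _ ≤ |P x - ∫ᵛ y, J y * filterKernel lam φ H (2 * N) x y ∂•ν| +
          |∫ᵛ y, J y * filterKernel lam φ H (2 * N) x y ∂•ν -
            ∫ᵛ y in B, J y * filterKernel lam φ H (2 * N) x y ∂•ν| := abs_sub_le _ _ _
      _ ≤ C₁ * N ^ (-S) + (C₂ * C₁) * (D + 1) * (2 * N) ^ (-τ) :=
          add_le_add (hglob x) (h3.trans (le_of_eq (by ring)))
      _ ≤ _ := by
          gcongr
          · exact le_max_left _ _
          · exact le_max_right _ _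

end DiffusionSpace

/-! ### The main theorem -/

open DiffusionSpace in
theorem theorem6p4 {X : Type*} [TopologicalSpace X] [MeasurableSpace X] [BorelSpace X]
    (ρ : X → X → ℝ) (μ : Measure X) [IsProbabilityMeasure μ]
    (lam : ℕ → ℝ) (φ : ℕ → X → ℝ) (α : ℝ)
    (hX : IsDiffusionMeasureSpace ρ μ lam φ α)
    (a : ℝ) (ha : StrongProduct lam φ a)
    (p : ℝ≥0∞) (hp : 1 ≤ p)
    (μs : ℕ → SignedMeasure X)
    (hμs_top : p = ∞ → IsUniformMZQuadrature μ lam φ a p μs)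
    (hμs : p ≠ ∞ → ∀ n, μs n = μ.toSignedMeasure)
    (νs : ℕ → SignedMeasure X)
    (hνs : IsUniformMZQuadrature μ lam φ a p νs)
    (hνs_supp : ∃ C : ℝ, ∀ n, (νs n).totalVariation.support.Finite ∧
      ((νs n).totalVariation.support.ncard : ℝ) ≤ C * ((2 : ℝ) ^ n) ^ α)
    (H : ℝ → ℝ) (hH : IsLowPass H)
    (x₀ : X) (t' t : ℝ) (ht' : 0 < t') (ht : t' < t)
    (ψ : X → ℝ) (hψ : ψ ∈ smoothFunctions μ lam φ)
    (hψ_one : ∀ x ∈ cball ρ x₀ t', ψ x = 1) (hψ_zero : ∀ x ∉ cball ρ x₀ t, ψ x = 0)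
    (s S : ℝ) (hs : 0 < s) (hS : max 1 s < S)
    (r₀ : ℝ) (hr₀ : 0 < r₀) :
    ∃ c C : ℝ, 0 < c ∧ 0 < C ∧
      ∀ r : ℝ, r₀ ≤ r → ∀ n : ℕ, ∀ N : ℝ, N = (2 : ℝ) ^ n →
      ∀ f ∈ cutoffSobolevBall μ lam φ p s ψ r,
        eLpNorm (f - sigmaCirc lam φ H S N (f * ψ) (μs n) (νs n) (cball ρ x₀ t)) p
            (μ.restrict (cball ρ x₀ t')) ≤ ENNReal.ofReal (c * r * N ^ (-s)) ∧
        eLpNorm (f * ψ - sigmaCirc lam φ H S N (f * ψ) (μs n) (νs n) univ) p μ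
            ≤ ENNReal.ofReal (c * r * N ^ (-s)) ∧
        ∀ ε : ℝ, ε = c * r * N ^ (-s) → ε ≤ 1 → ε ≤ r →
          (totalBits (νs n).totalVariation.support
              (quantize lam φ H S N (f * ψ) (μs n)) : ℝ)
            ≤ C * (r / ε) ^ (α / s) * (1 + Real.logb 2 (r / ε)) := by
  have hα := hX.alpha_pos
  have hS1 : 1 < S := (le_max_left _ _).trans_lt hS
  have hSs : s < S := (le_max_right _ _).trans_lt hS
  -- With `κ > 1` the radii `t' < t` alone do not separate `B'` from the complement of `B`. The
  -- cutoff does: it is continuous, equal to `1` on the compact `B'` and `0` outside `B`.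
  obtain ⟨δ, hδ, hsep⟩ := exists_forall_ne_zero_of_lt hX.quasiMetric hX.isOpen_iff
    (hX.isCompact_cball x₀ t' ht') hψ.1 (fun x hx => by rw [hψ_one x hx]; exact one_ne_zero)
  obtain ⟨C₁, hC₁, happ⟩ := hX.exists_approx hH ha hp hμs_top hμs hψ s
  -- The exponent `α + s` offsets the growth `N^α` of the bound for `P` and leaves `N^(-s)`.
  obtain ⟨C₂, hC₂, hq⟩ := hX.exists_quantization_error_le hH ha hp hνs hδ (α + s)
  obtain ⟨E, hE⟩ := hνs_supp
  -- The three parts are the approximation, rounding and truncation errors. Terms without a factor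
  -- `r` are absorbed through `1 ≤ r / r₀`.
  set c := C₁ + (C₂ / r₀ + C₂ * (C₁ + 1 / r₀)) with hc
  have hc0 : 0 < c := by positivity
  obtain ⟨C₃, hC₃, hbits⟩ := exists_totalBits_le (X := X) (α := α) (S := S) (D := C₁) (E := E)
    hs hc0 hC₁.le
  refine ⟨c, C₃, hc0, hC₃, ?_⟩
  rintro r hr n N rfl f hf
  have hr0 : 0 < r := by linarith
  obtain ⟨hgm, hgσ, hσ⟩ := happ n r hr0 f hf
  have hN1 : (1 : ℝ) ≤ 2 ^ n := one_le_pow₀ (by norm_num)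
  have hN0 : (0 : ℝ) < 2 ^ n := by positivity
  set N : ℝ := 2 ^ n with hN
  set P := sigma lam φ H N (f * ψ) (μs n) with hPdef
  have hP : P ∈ diffPoly lam φ N := hX.sigma_mem hH hN0 _ _
  obtain ⟨hglob, hloc⟩ := hq n S (C₁ * r * N ^ α) (cball ρ x₀ t) (by linarith) (by positivity)
    (hX.measurableSet_cball x₀ (ht'.trans ht)) P hP hσ
  have hum : AEStronglyMeasurable (f * ψ - P) μ :=
    hgm.sub (hX.continuous_of_mem hP).measurable.aestronglyMeasurable
  have hNs : 0 < N ^ (-s) := by positivity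
  have hr1 : 1 ≤ r / r₀ := (one_le_div hr₀).2 hr
  have hNα : 1 ≤ N ^ α := Real.one_le_rpow hN1 hα.le
  have hq1 : C₂ * N ^ (-S) ≤ C₂ / r₀ * r * N ^ (-s) := by
    calc C₂ * N ^ (-S) ≤ C₂ * (1 * N ^ (-s)) := by
          rw [one_mul]
          gcongr
      _ ≤ C₂ * (r / r₀ * N ^ (-s)) := by gcongr
      _ = _ := by ring
  have hq2 : C₂ * (C₁ * r * N ^ α + 1) * (2 * N) ^ (-(α + s)) ≤
      C₂ * (C₁ + 1 / r₀) * r * N ^ (-s) := by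
    have h1 : (2 * N) ^ (-(α + s)) ≤ (N ^ α)⁻¹ * N ^ (-s) := by
      rw [← Real.rpow_neg hN0.le, ← Real.rpow_add hN0, ← neg_add]
      exact Real.rpow_le_rpow_of_nonpos hN0 (by linarith) (by linarith)
    have h2 : C₁ * r * N ^ α + 1 ≤ (C₁ + 1 / r₀) * r * N ^ α := by
      have : 1 ≤ r / r₀ * N ^ α := one_le_mul_of_one_le_of_one_le hr1 hNα
      calc _ ≤ C₁ * r * N ^ α + r / r₀ * N ^ α := by gcongr
        _ = _ := by ring
    calc _ ≤ C₂ * ((C₁ + 1 / r₀) * r * N ^ α) * ((N ^ α)⁻¹ * N ^ (-s)) := by gcongr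
      _ = _ := by field_simp
  refine ⟨?_, ?_, fun ε hε hε1 hεr => ?_⟩
  · have hD : C₂ * N ^ (-S) + C₂ * (C₁ * r * N ^ α + 1) * (2 * N) ^ (-(α + s)) ≤
        (C₂ / r₀ + C₂ * (C₁ + 1 / r₀)) * r * N ^ (-s) := by
      refine (add_le_add hq1 hq2).trans (le_of_eq (by ring))
    refine (eLpNorm_sub_le_of_abs_le Measure.restrict_le_self hp (by positivity)
      (by positivity) hum hgσ (D := (C₂ / r₀ + C₂ * (C₁ + 1 / r₀)) * r * N ^ (-s)) ?_).trans
      (le_of_eq (by rw [hc]; congr 1; ring))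
    filter_upwards [ae_restrict_mem (hX.measurableSet_cball x₀ ht')] with x hx
    have h1 : f x = (f * ψ) x := by rw [Pi.mul_apply, hψ_one x hx, mul_one]
    have h2 := hloc x fun y hy => by
      by_contra h
      exact hsep x hx y (not_le.1 h) (hψ_zero y hy)
    rw [h1]
    exact (abs_sub_le _ (P x) _).trans (add_le_add le_rfl (h2.trans hD))
  · refine (eLpNorm_sub_le_of_abs_le le_rfl hp (by positivity)
      (by positivity) hum hgσ (D := C₂ / r₀ * r * N ^ (-s)) ?_).trans ?_
    · refine Eventually.of_forall fun x => ?_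
      refine (abs_sub_le _ (P x) _).trans (add_le_add le_rfl ?_)
      have h2 := (hglob x).trans hq1
      rw [sigmaCirc, VectorMeasure.setIntegral_univ]
      exact h2
    · refine ENNReal.ofReal_le_ofReal ?_
      rw [← add_mul, ← add_mul, hc]
      gcongr
      have : 0 < C₂ * (C₁ + 1 / r₀) := by positivity
      linarith
  · exact hbits n r hr0 _ P (hE n).1 (hE n).2 hσ ε hε hε1 hεr
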